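/- Let $A$ be a finite alphabet and $\sigma : A \to A^+$ a substitution (a non-erasing morphism, extended to words and to $A^{\mathbb Z}$ by concatenation). Let $B$ be the set of bounded letters ($a\in A$ such that $(|\sigma^n(a)|)_{n\ge 0}$ is bounded) and $C = A\setminus B$ the set of growing letters. Let $C_{niso}$ be the set of those $c\in C$ for which there are no $n\ge 1$, $u\in B^+$, $v\in A^*$ with $\sigma^n(c)=ucv$ or $\sigma^n(c)=vcu$. Let $G$ be the directed graph whose vertices are the non-empty subsets of $C$, with exactly one edge $D\to D'$ from each vertex $D$, where $D'$ is the set of growing letters occurring in some $\sigma(a)$, $a\in D$. A vertex $D$ is a $k$-periodic alphabet if $k$ is the smallest positive integer such that $G$ has a path of $k$ edges from $D$ to $D$; it is a minimal alphabet of period $k$ if moreover no proper subset of $D$ is a periodic alphabet. In that case $\sigma^k$ restricts to a substitution $\sigma^k|_{D\cup B}: D\cup B\to (D\cup B)^+$. For a substitution $\tau$ on an alphabet $A'\subseteq A$, let $X_\tau$ be the set of all $x\in A'^{\mathbb Z}\subseteq A^{\mathbb Z}$ all of whose finite factors are factors of words $\tau^n(a)$, $a\in A'$, $n\ge 0$.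 Let $T$ be the left shift, and for $X\subseteq A^{\mathbb Z}$ put $\tilde\sigma(X)=\{T^j(\sigma(x)) : x\in X,\ j\in\mathbb Z\}$. A subshift is a non-empty closed set $X\subseteq A^{\mathbb Z}$ with $T(X)=X$; it is minimal if it contains no other subshift. A tame minimal component of $X_\sigma$ is a minimal subshift $X\subseteq X_\sigma$ with $X\not\subseteq B^{\mathbb Z}$. **Proposition.** Let $D\subseteq C_{niso}$ be a minimal alphabet of period $k$ and let $D\to E$ in $G$. Then $E\subseteq C_{niso}$, $E$ is a minimal alphabet of period $k$, and $$\tilde\sigma\left(X_{\sigma^k|_{D\cup B}}\right)=X_{\sigma^k|_{E\cup B}}.$$ Hence $\tilde\sigma$ permutes the tame minimal components of $X_\sigma$ as $G$ dictates. That is, sending a minimal alphabet $D\subseteq C_{niso}$, of period $k$, to $X_{\sigma^k|_{D\cup B}}$ defines a bijection from the minimal alphabets contained in $C_{niso}$ onto the tame minimal components of $X_\sigma$; for two such alphabets $D,E$, of periods $k,l$, one has $\tilde\sigma(X_{\sigma^k|_{D\cup B}})=X_{\sigma^l|_{E\cup B}}$ if and only if $D\to E$ in $G$; and $\tilde\sigma$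 restricts to a bijection of the set of tame minimal components of $X_\sigma$ onto itself. -/

import Mathlib

/-- The factor `x_i x_{i+1} ⋯ x_{i+n-1}` of length `n` of a two-sided sequence `x`. -/
def factorAt {A : Type*} (x : ℤ → A) (i : ℤ) (n : ℕ) : List A :=
  List.ofFn fun j : Fin n => x (i + (j : ℕ))

/-- The `k`-th power of the left shift, `(T^k x)_i = x_{i+k}`. -/
def shiftBy {A : Type*} (k : ℤ) (x : ℤ → A) : ℤ → A := fun i => x (i + k)

/-- Subshifts: non-empty sets of two-sided sequences, closed for the product of the discrete
topologies, and invariant under the left shift (`T(X) = X`). -/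
def IsSubshift {A : Type*} (X : Set (ℤ → A)) : Prop :=
  X.Nonempty ∧ @IsClosed (ℤ → A) (@Pi.topologicalSpace ℤ (fun _ => A) (fun _ => ⊥)) X ∧
    shiftBy 1 '' X = X

/-- A subshift is minimal if it contains no subshift other than itself. -/
def IsMinimalSubshift {A : Type*} (X : Set (ℤ → A)) : Prop :=
  IsSubshift X ∧ ∀ Y : Set (ℤ → A), IsSubshift Y → Y ⊆ X → Y = X

/-- A substitution `A → A⁺`, i.e. a non-erasing morphism, given by its values on letters. -/
structure Substitution (A : Type*) where
  toFun : A → List A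
  nonerasing : ∀ a, toFun a ≠ []

namespace Substitution

variable {A : Type*}

/-- The action on words, by concatenation. -/
def onWord (σ : Substitution A) (w : List A) : List A := w.flatMap σ.toFun

theorem length_le_onWord (σ : Substitution A) (w : List A) :
    w.length ≤ (σ.onWord w).length := by
  induction w with
  | nil => simp
  | cons a w ih =>
    have h : 0 < (σ.toFun a).length := List.length_pos_iff.2 (σ.nonerasing a)
    simp only [onWord, List.flatMap_cons, List.length_append, List.length_cons] at ih ⊢
    omega

theorem length_le_iterate (σ : Substitution A) (n : ℕ) (w : List A) :
    w.length ≤ (σ.onWord^[n] w).length := by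
  induction n generalizing w with
  | zero => simp
  | succ n ih =>
    rw [Function.iterate_succ_apply]
    exact (σ.length_le_onWord w).trans (ih _)

/-- The power `σ^k`. -/
def pow (σ : Substitution A) (k : ℕ) : Substitution A where
  toFun a := σ.onWord^[k] [a]
  nonerasing a h := by
    have := σ.length_le_iterate k [a]
    simp [h] at this

/-- The restriction `σ|_D : D → D⁺`, defined when `σ(D) ⊆ D⁺`. -/
def restrict (σ : Substitution A) (D : Set A) (h : ∀ a ∈ D, ∀ b ∈ σ.toFun a, b ∈ D) :
    Substitution D where
  toFun a := (σ.toFun a).attachWith (fun b => b ∈ D) (h a a.2)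
  nonerasing a h' := σ.nonerasing a (by simpa using h')

/-- The language of `σ`: all factors of the words `σ^n(a)`. -/
def language (σ : Substitution A) : Set (List A) :=
  {u | ∃ (a : A) (n : ℕ), u <:+: σ.onWord^[n] [a]}

/-- The substitution subshift `X_σ`. -/
def subshift (σ : Substitution A) : Set (ℤ → A) :=
  {x | ∀ (i : ℤ) (n : ℕ), factorAt x i n ∈ σ.language}

/-- The set `B` of bounded letters. -/
def bounded (σ : Substitution A) : Set A :=
  {a | ∃ M : ℕ, ∀ n : ℕ, (σ.onWord^[n] [a]).length ≤ M}

/-- The set `C` of growing letters. -/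
def growing (σ : Substitution A) : Set A := (σ.bounded)ᶜ

/-- The set of left-isolated letters. -/
def leftIsolated (σ : Substitution A) : Set A :=
  {c | c ∈ σ.growing ∧ ∃ n : ℕ, 1 ≤ n ∧ ∃ u v : List A,
    u ≠ [] ∧ (∀ b ∈ u, b ∈ σ.bounded) ∧ σ.onWord^[n] [c] = u ++ [c] ++ v}

/-- The set of right-isolated letters. -/
def rightIsolated (σ : Substitution A) : Set A :=
  {c | c ∈ σ.growing ∧ ∃ n : ℕ, 1 ≤ n ∧ ∃ u v : List A,
    u ≠ [] ∧ (∀ b ∈ u, b ∈ σ.bounded) ∧ σ.onWord^[n] [c] = v ++ [c] ++ u}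

/-- The set `C_niso` of growing letters that are neither left- nor right-isolated. -/
def nonIsolated (σ : Substitution A) : Set A :=
  {c | c ∈ σ.growing ∧ c ∉ σ.leftIsolated ∧ c ∉ σ.rightIsolated}

/-- The set of growing letters of a word. -/
def growingAlphabet (σ : Substitution A) (u : List A) : Set A := {c | c ∈ σ.growing ∧ c ∈ u}

/-- The vertices of the graph `G`: non-empty sets of growing letters. -/
def IsVertex (σ : Substitution A) (D : Set A) : Prop := D.Nonempty ∧ D ⊆ σ.growing

/-- The edges `D → D'` of the graph `G`. -/
def Arrow (σ : Substitution A) (D D' : Set A) : Prop :=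
  σ.IsVertex D ∧ σ.IsVertex D' ∧ D' = ⋃ a ∈ D, σ.growingAlphabet (σ.toFun a)

/-- Existence of a path of `k` edges from `D` to `D'` in the graph `G`. -/
def ArrowIter (σ : Substitution A) : ℕ → Set A → Set A → Prop
  | 0, D, D' => D = D'
  | k + 1, D, D' => ∃ F : Set A, σ.Arrow D F ∧ σ.ArrowIter k F D'

/-- `D` is a `k`-periodic alphabet: `k` is the smallest positive integer such that there is a path
of `k` edges from `D` to `D`. -/
def IsPeriodicAlphabet (σ : Substitution A) (k : ℕ) (D : Set A) : Prop :=
  σ.IsVertex D ∧ IsLeast {j : ℕ | 1 ≤ j ∧ σ.ArrowIter j D D} k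

/-- `D` is a minimal alphabet of period `k`: it is `k`-periodic and has no proper periodic
subalphabet. -/
def IsMinimalAlphabet (σ : Substitution A) (k : ℕ) (D : Set A) : Prop :=
  σ.IsPeriodicAlphabet k D ∧
    ∀ (D' : Set A) (k' : ℕ), σ.IsPeriodicAlphabet k' D' → D' ⊆ D → D' = D

theorem onWord_append (σ : Substitution A) (u v : List A) :
    σ.onWord (u ++ v) = σ.onWord u ++ σ.onWord v := by
  simp [onWord]

theorem iterate_append (σ : Substitution A) (n : ℕ) (u v : List A) :
    σ.onWord^[n] (u ++ v) = σ.onWord^[n] u ++ σ.onWord^[n] v := by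
  induction n generalizing u v with
  | zero => rfl
  | succ n ih => simp only [Function.iterate_succ_apply, onWord_append, ih]

theorem bounded_of_mem (σ : Substitution A) {a b : A} (ha : a ∈ σ.bounded)
    (hb : b ∈ σ.toFun a) : b ∈ σ.bounded := by
  obtain ⟨M, hM⟩ := ha
  refine ⟨M, fun n => ?_⟩
  have h := hM (n + 1)
  obtain ⟨s, t, hst⟩ := List.append_of_mem hb
  have e : σ.onWord [a] = s ++ ([b] ++ t) := by simp [onWord, hst]
  rw [Function.iterate_succ_apply, e, iterate_append, iterate_append] at h
  simp only [List.length_append] at h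
  omega

theorem arrowIter_mem (σ : Substitution A) {k : ℕ} {D D' : Set A} (h : σ.ArrowIter k D D')
    {w : List A} (hw : ∀ a ∈ w, a ∈ D ∪ σ.bounded) :
    ∀ b ∈ σ.onWord^[k] w, b ∈ D' ∪ σ.bounded := by
  induction k generalizing D w with
  | zero =>
    obtain rfl : D = D' := h
    exact hw
  | succ k ih =>
    obtain ⟨F, hF, hk⟩ := h
    rw [Function.iterate_succ_apply]
    refine ih hk fun b hb => ?_
    obtain ⟨a, haw, hba⟩ := List.mem_flatMap.1 hb
    by_cases hbB : b ∈ σ.bounded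
    · exact Or.inr hbB
    · rcases hw a haw with haD | haB
      · left
        rw [hF.2.2]
        exact Set.mem_biUnion haD ⟨hbB, hba⟩
      · exact absurd (σ.bounded_of_mem haB hba) hbB

theorem IsPeriodicAlphabet.stable {σ : Substitution A} {k : ℕ} {D : Set A}
    (h : σ.IsPeriodicAlphabet k D) :
    ∀ a ∈ D ∪ σ.bounded, ∀ b ∈ (σ.pow k).toFun a, b ∈ D ∪ σ.bounded := by
  intro a ha
  refine σ.arrowIter_mem h.2.1.2 ?_
  simpa using ha

/-- For a `k`-periodic alphabet `D`, the substitution subshift of `σ^k|_{D ∪ B}`, seen in `A^ℤ`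
through the inclusion of `D ∪ B` in `A`. -/
def alphabetSubshift (σ : Substitution A) {k : ℕ} {D : Set A} (h : σ.IsPeriodicAlphabet k D) :
    Set (ℤ → A) :=
  (fun (x : ℤ → ↥(D ∪ σ.bounded)) (i : ℤ) => (x i : A)) ''
    ((σ.pow k).restrict (D ∪ σ.bounded) h.stable).subshift

theorem length_factorAt (σ : Substitution A) (x : ℤ → A) (i : ℤ) (n : ℕ) :
    n ≤ (σ.onWord (factorAt x i n)).length := by
  have h := σ.length_le_onWord (factorAt x i n)
  simpa [factorAt] using h

/-- The action `σ(⋯ x_{-1} . x_0 x_1 ⋯) = ⋯ σ(x_{-1}) . σ(x_0) σ(x_1) ⋯` on two-sided sequences.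
The letter of index `n ≥ 0` is read in `σ(x_0 ⋯ x_n)` from the left, starting from `0`, and the
letter of index `-m` with `m ≥ 1` is read in `σ(x_{-m} ⋯ x_{-1})` from the right, starting from `1`;
these words are long enough since `σ` is non-erasing. -/
def onSeq (σ : Substitution A) (x : ℤ → A) : ℤ → A
  | Int.ofNat n =>
    (σ.onWord (factorAt x 0 (n + 1)))[n]'(σ.length_factorAt x 0 (n + 1))
  | Int.negSucc m =>
    (σ.onWord (factorAt x (Int.negSucc m) (m + 1)))[
      (σ.onWord (factorAt x (Int.negSucc m) (m + 1))).length - (m + 1)]'(by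
        have := σ.length_factorAt x (Int.negSucc m) (m + 1)
        omega)

/-- The map induced by `σ` on subshifts: `{T^k(σ(x)) | x ∈ X, k ∈ ℤ}`. -/
def induced (σ : Substitution A) (X : Set (ℤ → A)) : Set (ℤ → A) :=
  {y | ∃ x ∈ X, ∃ k : ℤ, y = shiftBy k (σ.onSeq x)}

/-- The tame minimal components of `X_σ`: the minimal subshifts contained in `X_σ` and not
contained in `B^ℤ`. -/
def IsTameMinimalComponent (σ : Substitution A) (X : Set (ℤ → A)) : Prop :=
  IsMinimalSubshift X ∧ X ⊆ σ.subshift ∧ ¬ X ⊆ {x | ∀ i : ℤ, x i ∈ σ.bounded}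

end Substitution

/-! Two facts carry the theorem. First, in the words generated by a closed alphabet without isolated
letters, factors made of bounded letters have bounded length
(`IsClosedAlphabet.exists_infix_bound`), whereas an isolated letter generates arbitrarily long ones
(`exists_long_of_not_nonIsolated`). Second, on a minimal alphabet `D` of period `k`, `σ^k` is
primitive: the `G`-orbit of a single letter of `D` eventually enters a periodic alphabet inside `D`,
which is `D` itself.

Hence, for `D` without isolated letters, a long generated word contains `σ^(k n)(v)` with `v` long,
so `v` has a letter of `D`, and primitivity makes the language uniformly recurrent. The subshift of
`D` is therefore minimal, and its growing letters give back `D`.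

Its image under `σ` is again a subshift, and every letter of `D` occurs in some `σ^(k-1)(e)` with `e
∈ E`, so the image lies in the subshift of `E`. The latter is minimal, since isolated letters in `E`
would force long bounded factors over `D`; the two are equal.

Conversely, bounded factors of a tame minimal component `X` have bounded length, otherwise a limit
would give a subshift of `X` inside `B^ℤ`. So for every `m` the language of `X` contains `σ^m(c)`
for a growing `c`. By the pigeonhole principle one `c` serves infinitely many exponents; the
periodic alphabet reached from `c` contains a minimal alphabet whose language lies in that of `X`,
and minimality of `X` gives equality (`IsTameMinimalComponent.exists_alphabet`). The bijectivity of
the induced map is then that of `G` on periodic vertices. -/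

/-! ### Factors of concatenations of words -/

theorem List.prefix_append_cases {α : Type*} {u a b : List α} (h : u <+: a ++ b) :
    u <+: a ∨ ∃ t, u = a ++ t ∧ t <+: b := by
  rcases List.prefix_or_prefix_of_prefix h (List.prefix_append a b) with h1 | ⟨t, rfl⟩
  · exact Or.inl h1
  · exact Or.inr ⟨t, rfl, (List.prefix_append_right_inj a).1 h⟩

/-- A prefix of a concatenation of blocks of length at most `l` contains all blocks of a prefix of
the block sequence, up to a remainder of length at most `l`. -/
theorem List.exists_prefix_flatMap {α β : Type*} (h : α → List β) {l : ℕ}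
    (hl : ∀ a, (h a).length ≤ l) (v : List α) {w : List β} (hw : w <+: v.flatMap h) :
    ∃ v', v' <+: v ∧ v'.flatMap h <+: w ∧ w.length ≤ l * (v'.length + 1) := by
  induction v generalizing w with
  | nil => exact ⟨[], List.nil_prefix, List.nil_prefix, by simp_all⟩
  | cons c v ih =>
    rw [List.flatMap_cons] at hw
    rcases List.prefix_append_cases hw with h1 | ⟨t, rfl, ht⟩
    · exact ⟨[], List.nil_prefix, List.nil_prefix, by simpa using h1.length_le.trans (hl c)⟩
    · obtain ⟨v', h1, h2, h3⟩ := ih ht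
      refine ⟨c :: v', (List.prefix_cons_inj c).2 h1, ?_, ?_⟩
      · rw [List.flatMap_cons]
        exact (List.prefix_append_right_inj _).2 h2
      · have := hl c
        simp only [List.length_append, List.length_cons]
        linarith [mul_add l (v'.length + 1) 1]

/-- The `2` accounts for the two blocks that may be cut, one at each end of `w`. -/
theorem List.exists_infix_flatMap {α β : Type*} (h : α → List β) {l : ℕ}
    (hl : ∀ a, (h a).length ≤ l) (v : List α) {w : List β} (hw : w <:+: v.flatMap h) :
    ∃ v', v' <:+: v ∧ v'.flatMap h <:+: w ∧ w.length ≤ l * (v'.length + 2) := by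
  induction v generalizing w with
  | nil => exact ⟨[], List.nil_infix, List.nil_infix, by simp_all⟩
  | cons c v ih =>
    rw [List.flatMap_cons, List.infix_append_iff] at hw
    rcases hw with h1 | h1 | ⟨s, t, rfl, hs, ht⟩
    · refine ⟨[], List.nil_infix, List.nil_infix, ?_⟩
      have := h1.length_le.trans (hl c)
      simp
      omega
    · obtain ⟨v', h1, h2, h3⟩ := ih h1
      exact ⟨v', List.infix_cons h1, h2, h3⟩
    · obtain ⟨v', h1, h2, h3⟩ := List.exists_prefix_flatMap h hl v ht
      refine ⟨v', List.infix_cons h1.isInfix, List.infix_append_of_infix_right h2.isInfix, ?_⟩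
      have := hs.length_le.trans (hl c)
      rw [List.length_append]
      linarith [mul_add l (v'.length + 1) 1]

theorem List.exists_first_not {α : Type*} (P : α → Prop) {w : List α} (h : ∃ a ∈ w, ¬ P a) :
    ∃ p c s, w = p ++ c :: s ∧ (∀ b ∈ p, P b) ∧ ¬ P c := by
  induction w with
  | nil => simp at h
  | cons a w ih =>
    by_cases ha : P a
    · obtain ⟨b, hb, hPb⟩ := h
      have hb' : b ∈ w := by
        rcases List.mem_cons.1 hb with rfl | h
        · exact absurd ha hPb
        · exact h
      obtain ⟨p, c, s, rfl, hp, hc⟩ := ih ⟨b, hb', hPb⟩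
      refine ⟨a :: p, c, s, rfl, ?_, hc⟩
      simpa [ha] using hp
    · exact ⟨[], a, w, rfl, by simp, ha⟩

/-! ### Bounded words and growing letters -/

namespace Substitution

variable {A : Type*}

/-- Words all of whose letters are bounded. -/
def IsBoundedWord (σ : Substitution A) (u : List A) : Prop := ∀ b ∈ u, b ∈ σ.bounded

theorem IsBoundedWord.mono {σ : Substitution A} {u w : List A} (hw : σ.IsBoundedWord w)
    (h : u <:+: w) : σ.IsBoundedWord u := fun b hb => hw b (h.subset hb)

theorem IsBoundedWord.onWord {σ : Substitution A} {w : List A} (hw : σ.IsBoundedWord w) :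
    σ.IsBoundedWord (σ.onWord w) := by
  intro b hb
  obtain ⟨a, ha, hb⟩ := List.mem_flatMap.1 hb
  exact σ.bounded_of_mem (hw a ha) hb

theorem IsBoundedWord.iterate {σ : Substitution A} {w : List A} (hw : σ.IsBoundedWord w) (n : ℕ) :
    σ.IsBoundedWord (σ.onWord^[n] w) := by
  induction n with
  | zero => exact hw
  | succ n ih =>
    rw [Function.iterate_succ_apply']
    exact ih.onWord

theorem IsBoundedWord.append {σ : Substitution A} {u v : List A} (hu : σ.IsBoundedWord u)
    (hv : σ.IsBoundedWord v) : σ.IsBoundedWord (u ++ v) := by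
  intro b hb
  rcases List.mem_append.1 hb with h | h
  · exact hu b h
  · exact hv b h

theorem onWord_singleton (σ : Substitution A) (a : A) : σ.onWord [a] = σ.toFun a := by
  simp [onWord]

theorem iterate_nil (σ : Substitution A) (n : ℕ) : σ.onWord^[n] [] = [] :=
  Function.iterate_fixed rfl n

theorem iterate_cons (σ : Substitution A) (n : ℕ) (a : A) (w : List A) :
    σ.onWord^[n] (a :: w) = σ.onWord^[n] [a] ++ σ.onWord^[n] w :=
  σ.iterate_append n [a] w

theorem iterate_eq_flatMap (σ : Substitution A) (n : ℕ) (w : List A) :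
    σ.onWord^[n] w = w.flatMap fun a => σ.onWord^[n] [a] := by
  induction w with
  | nil => simp [iterate_nil]
  | cons a w ih => rw [iterate_cons, List.flatMap_cons, ih]

theorem iterate_infix (σ : Substitution A) (n : ℕ) {u w : List A} (h : u <:+: w) :
    σ.onWord^[n] u <:+: σ.onWord^[n] w := by
  rw [iterate_eq_flatMap, σ.iterate_eq_flatMap n w]
  exact h.flatMap _

theorem iterate_prefix (σ : Substitution A) (n : ℕ) {u w : List A} (h : u <+: w) :
    σ.onWord^[n] u <+: σ.onWord^[n] w := by
  rw [iterate_eq_flatMap, σ.iterate_eq_flatMap n w]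
  exact h.flatMap _

theorem singleton_infix {α : Type*} {a : α} {w : List α} (h : a ∈ w) : [a] <:+: w := by
  obtain ⟨s, t, rfl⟩ := List.append_of_mem h
  exact ⟨s, t, by simp⟩

theorem iterate_infix_of_mem (σ : Substitution A) (n : ℕ) {a : A} {w : List A} (h : a ∈ w) :
    σ.onWord^[n] [a] <:+: σ.onWord^[n] w := σ.iterate_infix n (singleton_infix h)

theorem exists_forall_length_le [Finite A] (σ : Substitution A) :
    ∃ K, ∀ b ∈ σ.bounded, ∀ n, (σ.onWord^[n] [b]).length ≤ K := by
  have h : ∀ b : A, ∃ M, b ∈ σ.bounded → ∀ n, (σ.onWord^[n] [b]).length ≤ M := by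
    intro b
    by_cases hb : b ∈ σ.bounded
    · exact ⟨hb.choose, fun _ => hb.choose_spec⟩
    · exact ⟨0, fun h => absurd h hb⟩
  choose M hM using h
  obtain ⟨K, hK⟩ := (Set.finite_range M).bddAbove
  exact ⟨K, fun b hb n => (hM b hb n).trans (hK ⟨b, rfl⟩)⟩

theorem IsBoundedWord.length_iterate_le {σ : Substitution A} {K : ℕ}
    (hK : ∀ b ∈ σ.bounded, ∀ n, (σ.onWord^[n] [b]).length ≤ K) {w : List A}
    (hw : σ.IsBoundedWord w) (n : ℕ) : (σ.onWord^[n] w).length ≤ K * w.length := by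
  induction w with
  | nil => simp [iterate_nil]
  | cons a w ih =>
    have h1 := hK a (hw a (by simp)) n
    have h2 := ih (hw.mono ⟨[a], [], by simp⟩)
    rw [iterate_cons, List.length_append, List.length_cons, mul_add]
    omega

theorem IsBoundedWord.exists_length_iterate_le [Finite A] {σ : Substitution A} {w : List A}
    (hw : σ.IsBoundedWord w) : ∃ M, ∀ n, (σ.onWord^[n] w).length ≤ M :=
  let ⟨_, hK⟩ := σ.exists_forall_length_le
  ⟨_, hw.length_iterate_le hK⟩

/-- Lengths never decrease under `σ`, so `|σ^m(c)| ≤ |σ^m(σ^n(c))|`, and the right-hand side is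
bounded in `m`. -/
theorem mem_bounded_of_iterate [Finite A] {σ : Substitution A} {c : A} {n : ℕ}
    (h : σ.IsBoundedWord (σ.onWord^[n] [c])) : c ∈ σ.bounded := by
  obtain ⟨M, hM⟩ := h.exists_length_iterate_le
  refine ⟨M, fun m => ?_⟩
  refine le_trans ?_ (hM m)
  rw [← Function.iterate_add_apply, add_comm, Function.iterate_add_apply]
  exact σ.length_le_iterate _ _

theorem exists_growing_mem [Finite A] {σ : Substitution A} {c : A} (hc : c ∈ σ.growing) (n : ℕ) :
    ∃ d ∈ σ.onWord^[n] [c], d ∈ σ.growing := by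
  by_contra! h
  exact hc (mem_bounded_of_iterate (n := n) fun b hb => not_not.1 (h b hb))

theorem exists_first_growing [Finite A] {σ : Substitution A} {c : A} (hc : c ∈ σ.growing) :
    ∃ p d s, σ.toFun c = p ++ d :: s ∧ σ.IsBoundedWord p ∧ d ∈ σ.growing := by
  obtain ⟨d, hd, hdg⟩ := exists_growing_mem hc 1
  rw [Function.iterate_one, onWord_singleton] at hd
  exact List.exists_first_not (· ∈ σ.bounded) ⟨d, hd, hdg⟩

/-! ### Isolated letters and the length of bounded factors -/

/-- A set of growing letters, closed under taking the growing letters of images. -/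
structure IsClosedAlphabet (σ : Substitution A) (D : Set A) : Prop where
  growing : D ⊆ σ.growing
  closed : ∀ d ∈ D, ∀ c ∈ σ.toFun d, c ∈ σ.growing → c ∈ D

theorem IsClosedAlphabet.mem_iterate {σ : Substitution A} {D : Set A} (hD : σ.IsClosedAlphabet D)
    (n : ℕ) {w : List A} (hw : ∀ a ∈ w, a ∈ D ∪ σ.bounded) :
    ∀ c ∈ σ.onWord^[n] w, c ∈ D ∪ σ.bounded := by
  induction n with
  | zero => exact hw
  | succ n ih =>
    intro c hc
    rw [Function.iterate_succ_apply'] at hc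
    obtain ⟨a, ha, hca⟩ := List.mem_flatMap.1 hc
    by_cases hcB : c ∈ σ.bounded
    · exact Or.inr hcB
    · rcases ih a ha with haD | haB
      · exact Or.inl (hD.closed a haD c hca hcB)
      · exact absurd (σ.bounded_of_mem haB hca) hcB

theorem IsBoundedWord.not_prefix_cons_growing {σ : Substitution A} {u v : List A} {c : A}
    (hu : σ.IsBoundedWord u) (hc : c ∈ σ.growing) (h : u <+: c :: v) : u = [] := by
  rcases List.prefix_cons_iff.1 h with h | ⟨t, rfl, -⟩
  · exact h
  · exact absurd (hu c (by simp)) hc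

/-- Let `f d` be the first growing letter of `σ(d)`. If `d` has arbitrarily long bounded prefixes in
its iterates, so does `f d`, because the part of `σ(d)` before `f d` has images of bounded length.
On an `f`-periodic letter `e` of such an orbit, `σ^r(e) = w e v` with `w` bounded. As `e` is not
left-isolated, `w` is empty, so iterates of `e` have no non-empty bounded prefix. -/
theorem IsClosedAlphabet.exists_prefix_bound [Finite A] {σ : Substitution A} {D : Set A}
    (hD : σ.IsClosedAlphabet D) (hiso : ∀ d ∈ D, d ∉ σ.leftIsolated) :
    ∃ K, ∀ d ∈ D, ∀ n u, σ.IsBoundedWord u → u <+: σ.onWord^[n] [d] → u.length ≤ K := by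
  suffices H : ∀ d ∈ D, ∃ K, ∀ n u, σ.IsBoundedWord u → u <+: σ.onWord^[n] [d] →
      u.length ≤ K by
    have H' : ∀ d, ∃ K, d ∈ D → ∀ n u, σ.IsBoundedWord u → u <+: σ.onWord^[n] [d] →
        u.length ≤ K := by
      intro d
      by_cases hd : d ∈ D
      · exact (H d hd).imp fun K h _ => h
      · exact ⟨0, fun h => absurd h hd⟩
    choose M hM using H'
    obtain ⟨K, hK⟩ := (Set.finite_range M).bddAbove
    exact ⟨K, fun d hd n u h1 h2 => (hM d hd n u h1 h2).trans (hK ⟨d, rfl⟩)⟩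
  by_contra! hbad
  obtain ⟨d₀, hd₀, hbad₀⟩ := hbad
  have hfirst : ∀ d : A, ∃ d' : A, d ∈ D → d' ∈ D ∧ ∃ p s, σ.toFun d = p ++ d' :: s ∧
      σ.IsBoundedWord p := by
    intro d
    by_cases hd : d ∈ D
    · obtain ⟨p, d', s, h1, h2, h3⟩ := exists_first_growing (hD.growing hd)
      exact ⟨d', fun _ => ⟨hD.closed d hd d' (by simp [h1]) h3, p, s, h1, h2⟩⟩
    · exact ⟨d, fun h => absurd h hd⟩
  choose f hf using hfirst
  let bad : Set A := {d | d ∈ D ∧ ∀ K, ∃ n u, σ.IsBoundedWord u ∧ u <+: σ.onWord^[n] [d] ∧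
    K < u.length}
  have hfbad : ∀ d ∈ bad, f d ∈ bad := by
    rintro d ⟨hd, hdbad⟩
    obtain ⟨hfd, p, s, hps, hp⟩ := hf d hd
    refine ⟨hfd, fun K => ?_⟩
    obtain ⟨M, hM⟩ := hp.exists_length_iterate_le
    -- `M` pays for the prefix `σ^n(p)`; the extra `1` rules out `n = 0`, where `u` has at most one
    -- letter.
    obtain ⟨n, u, hu, hun, hlen⟩ := hdbad (K + M + 1)
    cases n with
    | zero =>
      have := hun.length_le
      simp at this
      omega
    | succ n =>
      rw [Function.iterate_succ_apply, onWord_singleton, hps, iterate_append, iterate_cons] at hun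
      rcases List.prefix_append_cases hun with h | ⟨t, rfl, ht⟩
      · have := h.length_le.trans (hM n)
        omega
      · have htB : σ.IsBoundedWord t := hu.mono List.infix_append_right
        refine ⟨n, t, htB, ?_, ?_⟩
        · rcases List.prefix_append_cases ht with h | ⟨t', rfl, -⟩
          · exact h
          · exact absurd (mem_bounded_of_iterate (htB.mono List.infix_append_left))
              (hD.growing hfd)
        · have := hM n
          rw [List.length_append] at hlen
          omega
  have hiter : ∀ m, ∀ d ∈ D, f^[m] d ∈ D ∧ ∃ w v, σ.onWord^[m] [d] = w ++ f^[m] d :: v ∧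
      σ.IsBoundedWord w := by
    intro m
    induction m with
    | zero => exact fun d hd => ⟨hd, [], [], rfl, by simp [IsBoundedWord]⟩
    | succ m ih =>
      intro d hd
      obtain ⟨h1, w, v, h2, h3⟩ := ih d hd
      obtain ⟨h4, p, s, h5, h6⟩ := hf _ h1
      rw [Function.iterate_succ_apply', Function.iterate_succ_apply', h2]
      refine ⟨h4, σ.onWord w ++ p, s ++ σ.onWord v, ?_, h3.onWord.append h6⟩
      rw [onWord_append]
      simp [onWord, h5]
  have hbaditer : ∀ m, f^[m] d₀ ∈ bad := by
    intro m
    induction m with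
    | zero => exact ⟨hd₀, hbad₀⟩
    | succ m ih =>
      rw [Function.iterate_succ_apply']
      exact hfbad _ ih
  obtain ⟨i, j, hij, hfij⟩ : ∃ i j, i < j ∧ f^[i] d₀ = f^[j] d₀ := by
    obtain ⟨i, j, hne, h⟩ := Finite.exists_ne_map_eq_of_infinite fun n : ℕ => f^[n] d₀
    rcases lt_or_gt_of_ne hne with h' | h'
    · exact ⟨i, j, h', h⟩
    · exact ⟨j, i, h', h.symm⟩
  obtain ⟨he, hebad⟩ := hbaditer i
  set e := f^[i] d₀ with hedef
  have hper : f^[j - i] e = e := by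
    rw [hedef, ← Function.iterate_add_apply, Nat.sub_add_cancel hij.le]
    exact hfij.symm
  obtain ⟨-, w, v, hwv, hw⟩ := hiter (j - i) e he
  rw [hper] at hwv
  have hw0 : w = [] := by
    by_contra hne
    exact hiso e he ⟨hD.growing he, j - i, by omega, w, v, hne, hw, by simp [hwv]⟩
  subst hw0
  have hstart : ∀ n, ∃ v', σ.onWord^[(j - i) * n] [e] = e :: v' := by
    intro n
    induction n with
    | zero => exact ⟨[], rfl⟩
    | succ n ih =>
      obtain ⟨v', hv'⟩ := ih
      rw [mul_add, mul_one, add_comm, Function.iterate_add_apply, hv', iterate_cons, hwv]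
      exact ⟨_, rfl⟩
  obtain ⟨n, u, hu, hun, hlen⟩ := hebad 0
  obtain ⟨v', hv'⟩ := hstart n
  -- Pushing `u` forward to an exponent that is a multiple of the period makes it a prefix of a word
  -- starting with `e`.
  have hle : n ≤ (j - i) * n := Nat.le_mul_of_pos_left n (by omega)
  have h1 := σ.iterate_prefix ((j - i) * n - n) hun
  rw [← Function.iterate_add_apply, Nat.sub_add_cancel hle, hv'] at h1
  have h2 := (hu.iterate _).not_prefix_cons_growing (hD.growing he) h1
  have h3 := σ.length_le_iterate ((j - i) * n - n) u
  rw [h2] at h3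
  simp at h3
  simp [h3] at hlen

/-- The mirror image of a substitution. -/
def mirror (σ : Substitution A) : Substitution A where
  toFun a := (σ.toFun a).reverse
  nonerasing a := by simpa using σ.nonerasing a

theorem mirror_onWord (σ : Substitution A) (w : List A) :
    σ.mirror.onWord w = (σ.onWord w.reverse).reverse := by
  induction w with
  | nil => rfl
  | cons a w ih =>
    rw [List.reverse_cons, onWord_append, List.reverse_append, ← ih]
    simp [onWord, mirror]

theorem mirror_iterate (σ : Substitution A) (n : ℕ) (w : List A) :
    σ.mirror.onWord^[n] w = (σ.onWord^[n] w.reverse).reverse := by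
  induction n with
  | zero => simp
  | succ n ih =>
    rw [Function.iterate_succ_apply', ih, mirror_onWord, List.reverse_reverse,
      Function.iterate_succ_apply']

theorem mirror_bounded (σ : Substitution A) : σ.mirror.bounded = σ.bounded := by
  ext a
  simp [bounded, mirror_iterate]

theorem mirror_growing (σ : Substitution A) : σ.mirror.growing = σ.growing := by
  simp [growing, mirror_bounded]

theorem mirror_leftIsolated (σ : Substitution A) : σ.mirror.leftIsolated ⊆ σ.rightIsolated := by
  rintro c ⟨hc, n, hn, u, v, hu, huB, h⟩
  rw [mirror_growing] at hc
  rw [mirror_bounded] at huB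
  refine ⟨hc, n, hn, u.reverse, v.reverse, by simpa using hu, by simpa using huB, ?_⟩
  rw [mirror_iterate] at h
  have := congrArg List.reverse h
  simpa using this

theorem IsClosedAlphabet.mirror {σ : Substitution A} {D : Set A} (hD : σ.IsClosedAlphabet D) :
    σ.mirror.IsClosedAlphabet D := by
  refine ⟨by simpa [mirror_growing] using hD.growing, fun d hd c hc hcg => ?_⟩
  rw [mirror_growing] at hcg
  exact hD.closed d hd c (by simpa [Substitution.mirror] using hc) hcg

/-- Mirror images exchange prefixes with suffixes and left- with right-isolated letters. -/
theorem IsClosedAlphabet.exists_suffix_bound [Finite A] {σ : Substitution A} {D : Set A}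
    (hD : σ.IsClosedAlphabet D) (hiso : ∀ d ∈ D, d ∉ σ.rightIsolated) :
    ∃ K, ∀ d ∈ D, ∀ n u, σ.IsBoundedWord u → u <:+ σ.onWord^[n] [d] → u.length ≤ K := by
  obtain ⟨K, hK⟩ := hD.mirror.exists_prefix_bound
    fun d hd h => hiso d hd (σ.mirror_leftIsolated h)
  refine ⟨K, fun d hd n u hu hs => ?_⟩
  have := hK d hd n u.reverse (by simpa [IsBoundedWord, mirror_bounded] using hu)
    (by simpa [mirror_iterate] using hs)
  simpa using this

/-- Bounded factors of the words generated by non-isolated letters have bounded length. -/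
theorem IsClosedAlphabet.exists_infix_bound [Finite A] {σ : Substitution A} {D : Set A}
    (hD : σ.IsClosedAlphabet D) (hiso : D ⊆ σ.nonIsolated) :
    ∃ K, ∀ d ∈ D, ∀ n u, σ.IsBoundedWord u → u <:+: σ.onWord^[n] [d] → u.length ≤ K := by
  obtain ⟨K₁, hK₁⟩ := hD.exists_prefix_bound fun d hd => (hiso hd).2.1
  obtain ⟨K₂, hK₂⟩ := hD.exists_suffix_bound fun d hd => (hiso hd).2.2
  obtain ⟨K₀, hK₀⟩ := σ.exists_forall_length_le
  -- A bounded prefix crosses only the images of bounded letters, each of length at most `K₀`, and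
  -- stops inside the first image of a letter of `D`.
  have hpre : ∀ n w, (∀ a ∈ w, a ∈ D ∪ σ.bounded) → ∀ u, σ.IsBoundedWord u →
      u <+: σ.onWord^[n] w → u.length ≤ K₀ * w.length + K₁ := by
    intro n w hw
    induction w with
    | nil =>
      intro u _ h
      rw [iterate_nil] at h
      simp [List.prefix_nil.1 h]
    | cons c w ih =>
      intro u hu h
      rw [iterate_cons] at h
      rw [List.length_cons, mul_add, mul_one]
      rcases List.prefix_append_cases h with h | ⟨t, rfl, ht⟩
      · rcases hw c (by simp) with hc | hc
        · exact (hK₁ c hc n u hu h).trans (by omega)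
        · exact (h.length_le.trans (hK₀ c hc n)).trans (by omega)
      · rcases hw c (by simp) with hc | hc
        · exact absurd (mem_bounded_of_iterate (hu.mono List.infix_append_left)) (hD.growing hc)
        · have h1 := hK₀ c hc n
          have h2 := ih (fun a ha => hw a (by simp [ha])) t (hu.mono List.infix_append_right) ht
          rw [List.length_append]
          omega
  -- A bounded factor either lies within the image of one letter or straddles several. Only the
  -- first case uses `K`, and as a maximum rather than a sum, so that a constant can survive the
  -- induction on `n`.
  have hinf : ∀ n K, (∀ d ∈ D, ∀ u, σ.IsBoundedWord u → u <:+: σ.onWord^[n] [d] →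
      u.length ≤ K) → ∀ w, (∀ a ∈ w, a ∈ D ∪ σ.bounded) → ∀ u, σ.IsBoundedWord u →
      u <:+: σ.onWord^[n] w → u.length ≤ max K (K₀ * w.length + K₁ + K₂) := by
    intro n K hK w hw
    induction w with
    | nil =>
      intro u _ h
      rw [iterate_nil] at h
      simp [List.infix_nil.1 h]
    | cons c w ih =>
      intro u hu h
      have hw' : ∀ a ∈ w, a ∈ D ∪ σ.bounded := fun a ha => hw a (by simp [ha])
      rw [iterate_cons, List.infix_append_iff] at h
      rw [List.length_cons, mul_add, mul_one]
      rcases h with h | h | ⟨s, t, rfl, hs, ht⟩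
      · rcases hw c (by simp) with hc | hc
        · exact (hK c hc u hu h).trans (le_max_left _ _)
        · exact (h.length_le.trans (hK₀ c hc n)).trans (by omega)
      · exact (ih hw' u hu h).trans (by omega)
      · have h1 := hpre n w hw' t (hu.mono List.infix_append_right) ht
        have h2 : s.length ≤ K₀ + K₂ := by
          rcases hw c (by simp) with hc | hc
          · exact (hK₂ c hc n s (hu.mono List.infix_append_left) hs).trans (by omega)
          · exact (hs.length_le.trans (hK₀ c hc n)).trans (by omega)
        rw [List.length_append]
        omega
  obtain ⟨M, hM⟩ := (Set.finite_range fun a => (σ.toFun a).length).bddAbove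
  -- This constant dominates the straddling bound for `σ(d)`, of length at most `M`; the `1` covers
  -- `n = 0`.
  refine ⟨K₀ * M + K₁ + K₂ + 1, fun d hd n => ?_⟩
  induction n generalizing d with
  | zero =>
    intro u _ h
    have := h.length_le
    simp at this
    omega
  | succ n ih =>
    intro u hu h
    rw [Function.iterate_succ_apply, onWord_singleton] at h
    have hw : ∀ a ∈ σ.toFun d, a ∈ D ∪ σ.bounded := by
      have := hD.mem_iterate 1 (w := [d]) (by simpa using Or.inl hd)
      simpa [onWord_singleton] using this
    have h1 := hinf n _ (fun d hd u hu h => ih d hd u hu h) _ hw u hu h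
    have h2 : (σ.toFun d).length ≤ M := hM ⟨d, rfl⟩
    have h3 := Nat.mul_le_mul_left K₀ h2
    omega

/-- Each application of `σ^n` inserts one more non-empty copy of `u` just before `c`, while the
earlier bounded prefix does not shrink. -/
theorem iterate_leftIsolated {σ : Substitution A} {n : ℕ} {u v : List A} {c : A}
    (hu : u ≠ []) (huB : σ.IsBoundedWord u) (h : σ.onWord^[n] [c] = u ++ [c] ++ v) (j : ℕ) :
    ∃ w s, σ.onWord^[n * j] [c] = w ++ c :: s ∧ σ.IsBoundedWord w ∧ j ≤ w.length := by
  induction j with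
  | zero => exact ⟨[], [], rfl, by simp [IsBoundedWord], by simp⟩
  | succ j ih =>
    obtain ⟨w, s, h1, h2, h3⟩ := ih
    refine ⟨σ.onWord^[n] w ++ u, v ++ σ.onWord^[n] s, ?_, (h2.iterate n).append huB, ?_⟩
    · rw [mul_add, mul_one, add_comm, Function.iterate_add_apply, h1, iterate_append, iterate_cons,
        h]
      simp
    · have := σ.length_le_iterate n w
      have := List.length_pos_iff.2 hu
      rw [List.length_append]
      omega

/-- The exponent is kept a multiple of `k` so that the factor belongs to the language of `σ^k`. -/
theorem exists_long_of_leftIsolated {σ : Substitution A} {c : A} (hc : c ∈ σ.leftIsolated)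
    {k : ℕ} (hk : 1 ≤ k) (K : ℕ) :
    ∃ m u, σ.IsBoundedWord u ∧ K < u.length ∧ u <:+: σ.onWord^[k * m] [c] := by
  obtain ⟨-, n, -, u, v, hu, huB, h⟩ := hc
  obtain ⟨w, s, h1, h2, h3⟩ := iterate_leftIsolated hu huB h (k * (K + 1))
  refine ⟨n * (K + 1), w, h2, ?_, ?_⟩
  · nlinarith
  · rw [mul_left_comm, h1]
    exact List.infix_append_left

/-- An isolated letter generates bounded factors of unbounded length. -/
theorem exists_long_of_not_nonIsolated {σ : Substitution A} {c : A} (hcg : c ∈ σ.growing)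
    (hc : c ∉ σ.nonIsolated) {k : ℕ} (hk : 1 ≤ k) (K : ℕ) :
    ∃ m u, σ.IsBoundedWord u ∧ K < u.length ∧ u <:+: σ.onWord^[k * m] [c] := by
  by_cases hl : c ∈ σ.leftIsolated
  · exact exists_long_of_leftIsolated hl hk K
  · have hr : c ∈ σ.rightIsolated := by
      by_contra hr
      exact hc ⟨hcg, hl, hr⟩
    obtain ⟨-, n, hn, u, v, hu, huB, h⟩ := hr
    have hl' : c ∈ σ.mirror.leftIsolated := by
      refine ⟨by rwa [mirror_growing], n, hn, u.reverse, v.reverse, by simpa using hu,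
        by simpa [mirror_bounded] using huB, ?_⟩
      rw [mirror_iterate]
      simp [h]
    obtain ⟨m, w, h1, h2, h3⟩ := exists_long_of_leftIsolated hl' hk K
    refine ⟨m, w.reverse, by simpa [IsBoundedWord, mirror_bounded] using h1, by simpa using h2, ?_⟩
    rw [mirror_iterate] at h3
    simpa using h3.reverse

end Substitution

/-! ### Two-sided sequences, subshifts and their languages -/

section Sequences

variable {A : Type*}

theorem factorAt_length (x : ℤ → A) (i : ℤ) (n : ℕ) : (factorAt x i n).length = n := by
  simp [factorAt]

theorem factorAt_add (x : ℤ → A) (i : ℤ) (m n : ℕ) :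
    factorAt x i (m + n) = factorAt x i m ++ factorAt x (i + m) n := by
  rw [factorAt, List.ofFn_add]
  simp [factorAt, add_assoc]

theorem factorAt_infix (x : ℤ → A) {i j : ℤ} {m n : ℕ} (h1 : i ≤ j) (h2 : j + m ≤ i + n) :
    factorAt x j m <:+: factorAt x i n := by
  obtain ⟨a, rfl⟩ := Int.le.dest h1
  obtain ⟨b, rfl⟩ : ∃ b, n = a + m + b := ⟨n - (a + m), by omega⟩
  rw [factorAt_add, factorAt_add]
  exact ⟨_, _, rfl⟩

theorem factorAt_shiftBy (x : ℤ → A) (k i : ℤ) (n : ℕ) :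
    factorAt (shiftBy k x) i n = factorAt x (i + k) n := by
  simp only [factorAt, shiftBy]
  congr 1
  ext j
  ring_nf

theorem factorAt_eq_iff {x y : ℤ → A} {i j : ℤ} {n : ℕ} :
    factorAt x i n = factorAt y j n ↔ ∀ t : ℕ, t < n → x (i + t) = y (j + t) := by
  rw [factorAt, factorAt, List.ofFn_inj, funext_iff]
  exact ⟨fun h t ht => h ⟨t, ht⟩, fun h t => h t t.2⟩

theorem factorAt_congr {x y : ℤ → A} {i : ℤ} {n : ℕ}
    (h : ∀ j, i ≤ j → j < i + n → x j = y j) : factorAt x i n = factorAt y i n :=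
  factorAt_eq_iff.2 fun t ht => h _ (by omega) (by omega)

theorem factorAt_map {B : Type*} (f : A → B) (x : ℤ → A) (i : ℤ) (n : ℕ) :
    factorAt (fun j => f (x j)) i n = (factorAt x i n).map f := by
  rw [factorAt, factorAt, List.map_ofFn]
  rfl

theorem exists_eq_factorAt_of_infix {x : ℤ → A} {i : ℤ} {n : ℕ} {u : List A}
    (h : u <:+: factorAt x i n) : ∃ j, u = factorAt x j u.length := by
  obtain ⟨s, t, h⟩ := h
  have hn : n = s.length + u.length + t.length := by
    have := congrArg List.length h
    simp only [List.length_append, factorAt_length] at this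
    omega
  subst hn
  rw [factorAt_add, factorAt_add] at h
  have h1 := List.append_inj h (by simp [factorAt_length])
  exact ⟨_, (List.append_inj h1.1 (by simp [factorAt_length])).2⟩

theorem shiftBy_shiftBy (k l : ℤ) (x : ℤ → A) : shiftBy k (shiftBy l x) = shiftBy (k + l) x := by
  ext i
  simp only [shiftBy]
  ring_nf

theorem shiftBy_zero (x : ℤ → A) : shiftBy 0 x = x := by
  ext i
  simp [shiftBy]

theorem isClosed_iff_forall_window [TopologicalSpace A] [DiscreteTopology A]
    {X : Set (ℤ → A)} : IsClosed X ↔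
      ∀ x, (∀ N : ℕ, ∃ y ∈ X, ∀ i : ℤ, i.natAbs ≤ N → y i = x i) → x ∈ X := by
  constructor
  · intro hX x hx
    rw [← hX.closure_eq, mem_closure_iff]
    intro U hU hxU
    obtain ⟨I, u, hu, hsub⟩ := isOpen_pi_iff.1 hU x hxU
    obtain ⟨N, hN⟩ := (I.finite_toSet.image Int.natAbs).bddAbove
    obtain ⟨y, hy, hyx⟩ := hx N
    refine ⟨y, hsub fun i hi => ?_, hy⟩
    have : i.natAbs ≤ N := hN ⟨i, hi, rfl⟩
    rw [hyx i (by omega)]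
    exact (hu i hi).2
  · intro h
    refine isClosed_of_closure_subset fun x hx => h x fun N => ?_
    have ho : IsOpen ((Set.Icc (-(N : ℤ)) N).pi fun i => {x i}) :=
      isOpen_set_pi (Set.finite_Icc _ _) fun i _ => isOpen_discrete _
    obtain ⟨y, hy1, hy2⟩ := mem_closure_iff.1 hx _ ho fun i _ => rfl
    exact ⟨y, hy2, fun i hi => hy1 i ⟨by omega, by omega⟩⟩

/-- Compactness of `A^ℤ`: `x` is a cluster point of the sequence. -/
theorem exists_limit [Finite A] (s : ℕ → ℤ → A) :
    ∃ x : ℤ → A, ∀ N : ℕ, ∃ n ≥ N, ∀ i : ℤ, i.natAbs ≤ N → s n i = x i := by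
  let _ : TopologicalSpace A := ⊥
  have _ : DiscreteTopology A := ⟨rfl⟩
  obtain ⟨x, hx⟩ := exists_clusterPt_of_compactSpace (Filter.map s Filter.atTop)
  have hx' : MapClusterPt x Filter.atTop s := hx
  refine ⟨x, fun N => ?_⟩
  have ho : IsOpen ((Set.Icc (-(N : ℤ)) N).pi fun i => {x i}) :=
    isOpen_set_pi (Set.finite_Icc _ _) fun i _ => isOpen_discrete _
  obtain ⟨n, hn, h⟩ := Filter.frequently_atTop.1 (hx'.frequently (ho.mem_nhds fun i _ => rfl)) N
  exact ⟨n, hn, fun i hi => h i ⟨by omega, by omega⟩⟩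

/-- The sequences all of whose factors are in `L`. -/
def subshiftOf (L : Set (List A)) : Set (ℤ → A) := {x | ∀ i n, factorAt x i n ∈ L}

/-- The set of factors of the elements of `X`. -/
def languageOf (X : Set (ℤ → A)) : Set (List A) := {u | ∃ x ∈ X, ∃ i, u = factorAt x i u.length}

theorem factorAt_mem_languageOf {X : Set (ℤ → A)} {x : ℤ → A} (hx : x ∈ X) (i : ℤ) (n : ℕ) :
    factorAt x i n ∈ languageOf X := ⟨x, hx, i, by rw [factorAt_length]⟩

theorem mem_languageOf_of_infix {X : Set (ℤ → A)} {u w : List A} (hw : w ∈ languageOf X)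
    (h : u <:+: w) : u ∈ languageOf X := by
  obtain ⟨x, hx, i, hi⟩ := hw
  rw [hi] at h
  obtain ⟨j, hj⟩ := exists_eq_factorAt_of_infix h
  exact ⟨x, hx, j, hj⟩

theorem isSubshift_iff {X : Set (ℤ → A)} : IsSubshift X ↔ X.Nonempty ∧
    (∀ x, (∀ N : ℕ, ∃ y ∈ X, ∀ i : ℤ, i.natAbs ≤ N → y i = x i) → x ∈ X) ∧
      shiftBy 1 '' X = X := by
  let _ : TopologicalSpace A := ⊥
  have _ : DiscreteTopology A := ⟨rfl⟩
  rw [← isClosed_iff_forall_window]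
  rfl

theorem image_shiftBy_one_eq {X : Set (ℤ → A)} (h : ∀ x ∈ X, ∀ k, shiftBy k x ∈ X) :
    shiftBy 1 '' X = X := by
  apply Set.Subset.antisymm
  · rintro _ ⟨x, hx, rfl⟩
    exact h x hx 1
  · intro x hx
    exact ⟨shiftBy (-1) x, h x hx _, by rw [shiftBy_shiftBy]; simp [shiftBy_zero]⟩

theorem IsSubshift.shiftBy_mem {X : Set (ℤ → A)} (hX : IsSubshift X) {x : ℤ → A} (hx : x ∈ X)
    (k : ℤ) : shiftBy k x ∈ X := by
  have h1 : ∀ x ∈ X, shiftBy 1 x ∈ X := fun x hx => hX.2.2 ▸ Set.mem_image_of_mem _ hx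
  have h2 : ∀ x ∈ X, shiftBy (-1) x ∈ X := by
    intro x hx
    rw [← hX.2.2] at hx
    obtain ⟨y, hy, rfl⟩ := hx
    rw [shiftBy_shiftBy]
    simpa [shiftBy_zero] using hy
  induction k using Int.induction_on with
  | zero => rwa [shiftBy_zero]
  | succ n ih =>
    rw [add_comm, ← shiftBy_shiftBy]
    exact h1 _ ih
  | pred n ih =>
    rw [sub_eq_neg_add, ← shiftBy_shiftBy]
    exact h2 _ ih

theorem IsSubshift.mem_of_factors {X : Set (ℤ → A)} (hX : IsSubshift X) {x : ℤ → A}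
    (h : ∀ N : ℕ, factorAt x (-N) (2 * N + 1) ∈ languageOf X) : x ∈ X := by
  refine (isSubshift_iff.1 hX).2.1 x fun N => ?_
  obtain ⟨y, hy, j, hj⟩ := h N
  rw [factorAt_length, factorAt_eq_iff] at hj
  refine ⟨shiftBy (j + N) y, hX.shiftBy_mem hy _, fun i hi => ?_⟩
  have := hj (i + N).toNat (by omega)
  rw [Int.toNat_of_nonneg (by omega)] at this
  rw [shiftBy, show i + (j + N) = j + (i + N) by ring, ← this]
  ring_nf

theorem isSubshift_subshiftOf {L : Set (List A)} (h : (subshiftOf L).Nonempty) :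
    IsSubshift (subshiftOf L) := by
  refine isSubshift_iff.2 ⟨h, fun x hx i n => ?_, image_shiftBy_one_eq fun x hx k i n => ?_⟩
  · obtain ⟨y, hy, hyx⟩ := hx (i.natAbs + n)
    rw [← factorAt_congr fun j h1 h2 => hyx j (by omega)]
    exact hy i n
  · rw [factorAt_shiftBy]
    exact hx _ n

theorem subshiftOf_nonempty [Finite A] {L : Set (List A)} (hL : ∀ w ∈ L, ∀ u, u <:+: w → u ∈ L)
    (hlong : ∀ N : ℕ, ∃ w ∈ L, N ≤ w.length) : (subshiftOf L).Nonempty := by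
  choose w hw hlen using hlong
  obtain ⟨a, -⟩ := List.exists_mem_of_length_pos (hlen 1)
  -- The word of length at least `2N + 1` is placed from position `-N` on; the values outside `[-N,
  -- N]` do not matter in the limit.
  let s : ℕ → ℤ → A := fun N i => (w (2 * N + 1))[(i + N).toNat]?.getD a
  obtain ⟨x, hx⟩ := exists_limit s
  have hs : ∀ N : ℕ, factorAt (s N) (-N) (2 * N + 1) <+: w (2 * N + 1) := by
    intro N
    rw [List.prefix_iff_getElem]
    refine ⟨by rw [factorAt_length]; exact hlen _, fun t ht => ?_⟩
    rw [factorAt_length] at ht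
    have h : t < (w (2 * N + 1)).length := ht.trans_le (hlen _)
    simp only [factorAt, List.getElem_ofFn, s]
    rw [show (-(N : ℤ) + t + N).toNat = t by omega, List.getElem?_eq_getElem h, Option.getD_some]
  refine ⟨x, fun i n => ?_⟩
  obtain ⟨N, hN, hxN⟩ := hx (i.natAbs + n)
  rw [← factorAt_congr fun j h1 h2 => hxN j (by omega)]
  exact hL _ (hw _) _ ((factorAt_infix _ (by omega) (by omega)).trans (hs N).isInfix)

/-- A language in which every word occurs in all words that are long enough. -/
def IsUniformlyRecurrent (L : Set (List A)) : Prop :=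
  ∀ u ∈ L, ∃ R : ℕ, ∀ w ∈ L, R ≤ w.length → u <:+: w

theorem IsUniformlyRecurrent.mem_languageOf {L : Set (List A)} (hL : IsUniformlyRecurrent L)
    {Y : Set (ℤ → A)} (hY : Y.Nonempty) (hYL : Y ⊆ subshiftOf L) {u : List A} (hu : u ∈ L) :
    u ∈ languageOf Y := by
  obtain ⟨y, hy⟩ := hY
  obtain ⟨R, hR⟩ := hL u hu
  exact mem_languageOf_of_infix (factorAt_mem_languageOf hy 0 R)
    (hR _ (hYL hy 0 R) (factorAt_length y 0 R).ge)

/-- Any point of a smaller subshift `Y` already contains every word of `L`, and a subshift is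
determined by its language. -/
theorem IsUniformlyRecurrent.isMinimalSubshift {L : Set (List A)} (hL : IsUniformlyRecurrent L)
    (h : (subshiftOf L).Nonempty) : IsMinimalSubshift (subshiftOf L) := by
  refine ⟨isSubshift_subshiftOf h, fun Y hY hYX => hYX.antisymm fun x hx => ?_⟩
  exact hY.mem_of_factors fun N => hL.mem_languageOf hY.1 hYX (hx _ _)

end Sequences

/-! ### The action of a substitution on two-sided sequences -/

namespace Substitution

variable {A : Type*}

/-- The words `σ(x_0 ⋯ x_{r-1})` are prefixes of one another, so the letter read does not depend on
the window chosen in `onSeq`. -/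
theorem getElem?_onWord_factorAt_nonneg (σ : Substitution A) (x : ℤ → A) (r t : ℕ)
    (ht : t < (σ.onWord (factorAt x 0 r)).length) :
    (σ.onWord (factorAt x 0 r))[t]? = some (σ.onSeq x t) := by
  have h0 : (σ.onWord (factorAt x 0 (t + 1)))[t]? = some (σ.onSeq x t) := by
    have h : t < (σ.onWord (factorAt x 0 (t + 1))).length := σ.length_factorAt x 0 (t + 1)
    rw [List.getElem?_eq_getElem h]
    rfl
  rw [← h0]
  rcases le_total r (t + 1) with h | h
  · obtain ⟨s, hs⟩ := Nat.exists_eq_add_of_le h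
    rw [hs, factorAt_add, onWord_append, List.getElem?_append_left ht]
  · obtain ⟨s, hs⟩ := Nat.exists_eq_add_of_le h
    rw [hs, factorAt_add, onWord_append,
      List.getElem?_append_left (σ.length_factorAt x 0 (t + 1))]

theorem getElem?_onWord_factorAt_neg (σ : Substitution A) (x : ℤ → A) (l m : ℕ)
    (hm : m < (σ.onWord (factorAt x (-l) l)).length) :
    (σ.onWord (factorAt x (-l) l)).reverse[m]? = some (σ.onSeq x (Int.negSucc m)) := by
  have hpos := σ.length_factorAt x (-(m + 1 : ℕ)) (m + 1)
  have h0 : (σ.onWord (factorAt x (-(m + 1 : ℕ)) (m + 1))).reverse[m]? =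
      some (σ.onSeq x (Int.negSucc m)) := by
    rw [List.getElem?_reverse (by omega), List.getElem?_eq_getElem (by omega)]
    simp only [onSeq, Int.negSucc_eq, Nat.cast_add, Nat.cast_one, Nat.sub_sub, Nat.add_comm 1 m]
  rw [← h0]
  rcases le_total l (m + 1) with h | h
  · obtain ⟨s, hs⟩ := Nat.exists_eq_add_of_le' h
    have e : (-(m + 1 : ℕ) : ℤ) + s = -l := by omega
    rw [hs] at e ⊢
    rw [factorAt_add, e, onWord_append, List.reverse_append,
      List.getElem?_append_left (by simpa using hm)]
  · obtain ⟨s, hs⟩ := Nat.exists_eq_add_of_le' h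
    have e : (-l : ℤ) + s = -(m + 1 : ℕ) := by omega
    rw [hs] at e ⊢
    rw [factorAt_add, e, onWord_append, List.reverse_append,
      List.getElem?_append_left (by rw [List.length_reverse]; omega)]

/-- The factors of `σ(x)` aligned with `σ(x_{-l} ⋯ x_{-1}) . σ(x_0 ⋯ x_{r-1})`. -/
theorem factorAt_onSeq (σ : Substitution A) (x : ℤ → A) (l r : ℕ) :
    factorAt (σ.onSeq x) (-(σ.onWord (factorAt x (-l) l)).length)
      (σ.onWord (factorAt x (-l) (l + r))).length = σ.onWord (factorAt x (-l) (l + r)) := by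
  have h1 : factorAt (σ.onSeq x) 0 (σ.onWord (factorAt x 0 r)).length =
      σ.onWord (factorAt x 0 r) := by
    refine List.ext_getElem? fun t => ?_
    by_cases ht : t < (σ.onWord (factorAt x 0 r)).length
    · rw [getElem?_onWord_factorAt_nonneg σ x r t ht]
      rw [List.getElem?_eq_getElem (by rwa [factorAt_length])]
      simp only [factorAt, List.getElem_ofFn, zero_add]
      rfl
    · rw [List.getElem?_eq_none (by rw [factorAt_length]; omega), List.getElem?_eq_none (by omega)]
  have h2 : factorAt (σ.onSeq x) (-(σ.onWord (factorAt x (-l) l)).length)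
      (σ.onWord (factorAt x (-l) l)).length = σ.onWord (factorAt x (-l) l) := by
    refine List.ext_getElem? fun t => ?_
    by_cases ht : t < (σ.onWord (factorAt x (-l) l)).length
    · have h := getElem?_onWord_factorAt_neg σ x l
        ((σ.onWord (factorAt x (-l) l)).length - 1 - t) (by omega)
      rw [List.getElem?_reverse (by omega)] at h
      rw [show (σ.onWord (factorAt x (-l) l)).length - 1 -
        ((σ.onWord (factorAt x (-l) l)).length - 1 - t) = t by omega] at h
      rw [h, List.getElem?_eq_getElem (by rwa [factorAt_length])]
      simp only [factorAt, List.getElem_ofFn, Option.some.injEq]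
      congr 1
      rw [Int.negSucc_eq]
      simp only [factorAt] at ht
      omega
    · rw [List.getElem?_eq_none (by rw [factorAt_length]; omega), List.getElem?_eq_none (by omega)]
  rw [factorAt_add, onWord_append, List.length_append, factorAt_add, h2, neg_add_cancel,
    neg_add_cancel, h1]

/-- The same word `σ(x_{-N} ⋯ x_N)` is read around the origin of `x` and around that of its shift;
the two origins are `|σ(x_0)|` apart. -/
theorem onSeq_shiftBy_one (σ : Substitution A) (x : ℤ → A) :
    σ.onSeq (shiftBy 1 x) = shiftBy (σ.toFun (x 0)).length (σ.onSeq x) := by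
  ext i
  set N := i.natAbs + 1 with hN
  have h1 := σ.factorAt_onSeq (shiftBy 1 x) (N + 1) N
  have h2 := σ.factorAt_onSeq x N (N + 1)
  have e : ((-(N + 1 : ℕ) : ℤ) + 1) = -N := by omega
  have e2 : N + 1 + N = N + (N + 1) := by ring
  have e3 : (σ.onWord (factorAt x (-N) (N + 1))).length =
      (σ.onWord (factorAt x (-N) N)).length + (σ.toFun (x 0)).length := by
    rw [factorAt_add, onWord_append, List.length_append]
    simp [factorAt, onWord]
  rw [factorAt_shiftBy, factorAt_shiftBy, e, e3, e2] at h1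
  have h3 : ∀ M : ℕ, factorAt (σ.onSeq x) (-(σ.onWord (factorAt x (-N) N)).length) M =
      factorAt (shiftBy (σ.toFun (x 0)).length (σ.onSeq x))
        (-((σ.onWord (factorAt x (-N) N)).length + (σ.toFun (x 0)).length : ℕ)) M := by
    intro M
    rw [factorAt_shiftBy]
    congr 1
    push_cast
    ring
  rw [h3] at h2
  have h4 := factorAt_eq_iff.1 (h1.trans h2.symm)
  have l1 := σ.length_factorAt x (-N) N
  have l2 := σ.length_factorAt x (-N) (N + (N + 1))
  have l3 : (σ.onWord (factorAt x (-N) (N + (N + 1)))).length =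
      (σ.onWord (factorAt x (-N) (N + 1))).length + (σ.onWord (factorAt x 1 N)).length := by
    rw [show N + (N + 1) = (N + 1) + N by ring, factorAt_add, onWord_append, List.length_append]
    congr 4
    push_cast
    ring
  have l4 := σ.length_factorAt x 1 N
  have := h4 (i + ((σ.onWord (factorAt x (-N) N)).length + (σ.toFun (x 0)).length : ℕ)).toNat
    (by omega)
  rw [Int.toNat_of_nonneg (by omega)] at this
  rwa [neg_add_cancel_comm_assoc] at this

theorem onSeq_congr (σ : Substitution A) {x y : ℤ → A} {N : ℕ}
    (h : ∀ i : ℤ, i.natAbs ≤ N → x i = y i) : ∀ i : ℤ, i.natAbs ≤ N → σ.onSeq x i = σ.onSeq y i := by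
  intro i hi
  obtain ⟨n, rfl⟩ | ⟨m, rfl⟩ : (∃ n : ℕ, i = n) ∨ ∃ m : ℕ, i = Int.negSucc m := by
    cases i with
    | ofNat n => exact Or.inl ⟨n, rfl⟩
    | negSucc m => exact Or.inr ⟨m, rfl⟩
  · have e : factorAt x 0 (n + 1) = factorAt y 0 (n + 1) :=
      factorAt_congr fun j h1 h2 => h j (by omega)
    have h1 := σ.getElem?_onWord_factorAt_nonneg x (n + 1) n (σ.length_factorAt x 0 (n + 1))
    have h2 := σ.getElem?_onWord_factorAt_nonneg y (n + 1) n (σ.length_factorAt y 0 (n + 1))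
    rw [e, h2] at h1
    exact (Option.some.inj h1).symm
  · have e : factorAt x (-(m + 1 : ℕ)) (m + 1) = factorAt y (-(m + 1 : ℕ)) (m + 1) :=
      factorAt_congr fun j h1 h2 => h j (by omega)
    have h1 := σ.getElem?_onWord_factorAt_neg x (m + 1) m (σ.length_factorAt x _ (m + 1))
    have h2 := σ.getElem?_onWord_factorAt_neg y (m + 1) m (σ.length_factorAt y _ (m + 1))
    rw [e, h2] at h1
    exact (Option.some.inj h1).symm

theorem factorAt_onSeq_infix (σ : Substitution A) (x : ℤ → A) (i : ℤ) (n : ℕ) :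
    ∃ j m, factorAt (σ.onSeq x) i n <:+: σ.onWord (factorAt x j m) := by
  set N := i.natAbs + n with hN
  refine ⟨-N, N + N, ?_⟩
  rw [← σ.factorAt_onSeq x N N]
  have l1 := σ.length_factorAt x (-N) N
  have l2 := σ.length_factorAt x 0 N
  have l3 : (σ.onWord (factorAt x (-N) (N + N))).length =
      (σ.onWord (factorAt x (-N) N)).length + (σ.onWord (factorAt x 0 N)).length := by
    rw [factorAt_add, onWord_append, List.length_append, neg_add_cancel]
  exact factorAt_infix _ (by omega) (by omega)

/-- Every shift of `σ(x)` is a shift by less than `|σ(y_0)|` of `σ(y)`, for a shift `y` of `x`. -/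
theorem exists_shiftBy_onSeq_eq (σ : Substitution A) (x : ℤ → A) (k : ℤ) :
    ∃ (i : ℤ) (j : ℕ), j < (σ.toFun (shiftBy i x 0)).length ∧
      shiftBy k (σ.onSeq x) = shiftBy j (σ.onSeq (shiftBy i x)) := by
  have hpos : ∀ a, 0 < (σ.toFun a).length := fun a => List.length_pos_iff.2 (σ.nonerasing a)
  induction k using Int.induction_on with
  | zero => exact ⟨0, 0, hpos _, by simp [shiftBy_zero]⟩
  | succ n ih =>
    obtain ⟨i, j, hj, h⟩ := ih
    rw [add_comm, ← shiftBy_shiftBy, h, shiftBy_shiftBy]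
    by_cases hj' : j + 1 < (σ.toFun (shiftBy i x 0)).length
    · refine ⟨i, j + 1, hj', ?_⟩
      push_cast
      rw [add_comm]
    · refine ⟨1 + i, 0, hpos _, ?_⟩
      have e : (1 + j : ℤ) = (σ.toFun (shiftBy i x 0)).length := by omega
      rw [← shiftBy_shiftBy 1 i x, onSeq_shiftBy_one, e, Nat.cast_zero, shiftBy_zero]
  | pred n ih =>
    obtain ⟨i, j, hj, h⟩ := ih
    rw [sub_eq_neg_add, ← shiftBy_shiftBy, h, shiftBy_shiftBy]
    by_cases hj' : j = 0
    · have h1 := σ.onSeq_shiftBy_one (shiftBy (-1 + i) x)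
      have hp := hpos (shiftBy (-1 + i) x 0)
      refine ⟨-1 + i, (σ.toFun (shiftBy (-1 + i) x 0)).length - 1, by omega, ?_⟩
      rw [shiftBy_shiftBy, ← add_assoc, add_neg_cancel, zero_add] at h1
      rw [h1, hj', shiftBy_shiftBy]
      congr 1
      omega
    · refine ⟨i, j - 1, by omega, ?_⟩
      congr 1
      omega

/-- The image of a subshift under the map induced by a substitution is a subshift. -/
theorem isSubshift_induced [Finite A] (σ : Substitution A) {X : Set (ℤ → A)}
    (hX : IsSubshift X) : IsSubshift (σ.induced X) := by
  refine isSubshift_iff.2 ⟨?_, fun y hy => ?_, image_shiftBy_one_eq ?_⟩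
  · obtain ⟨x, hx⟩ := hX.1
    exact ⟨_, x, hx, 0, rfl⟩
  · obtain ⟨M, hM⟩ := (Set.finite_range fun a => (σ.toFun a).length).bddAbove
    -- Replacing `x` by one of its shifts makes the outer shift smaller than `M`, hence confined to
    -- a finite set.
    have h : ∀ N : ℕ, ∃ x ∈ X, ∃ j : Fin M, ∀ i : ℤ, i.natAbs ≤ N →
        shiftBy (j : ℕ) (σ.onSeq x) i = y i := by
      intro N
      obtain ⟨z, ⟨x, hx, k, rfl⟩, hz⟩ := hy N
      obtain ⟨i, j, hj, h⟩ := σ.exists_shiftBy_onSeq_eq x k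
      rw [h] at hz
      exact ⟨shiftBy i x, hX.shiftBy_mem hx i, ⟨j, hj.trans_le (hM ⟨_, rfl⟩)⟩, hz⟩
    choose s hs j hj using h
    -- Recording `j N` as a second coordinate makes one compactness argument yield the limit point
    -- and the limit shift together.
    obtain ⟨p, hp⟩ := exists_limit fun N i => (s N i, j N)
    have hp2 : ∀ i, (p i).2 = (p 0).2 := by
      intro i
      obtain ⟨n, -, h⟩ := hp i.natAbs
      rw [← h i (by omega), ← h 0 (by simp)]
    refine ⟨fun i => (p i).1, ?_, ((p 0).2 : ℕ), ?_⟩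
    · refine (isSubshift_iff.1 hX).2.1 _ fun N => ?_
      obtain ⟨n, -, h⟩ := hp N
      exact ⟨s n, hs n, fun i hi => congrArg Prod.fst (h i hi)⟩
    · ext i
      -- The window must contain `i` shifted by the limit shift, which is less than `M`.
      obtain ⟨n, hn, h⟩ := hp (i.natAbs + M)
      have h1 : j n = (p 0).2 := congrArg Prod.snd (h 0 (by simp))
      rw [← hj n i (by omega), h1]
      have hlt := (p 0).2.2
      exact σ.onSeq_congr (fun t ht => congrArg Prod.fst (h t ht)) _
        (by omega)
  · rintro _ ⟨x, hx, k, rfl⟩ l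
    exact ⟨x, hx, l + k, shiftBy_shiftBy _ _ _⟩

end Substitution

/-! ### Dynamics of the graph of alphabets -/

theorem Function.exists_iterate_idempotent {α : Type*} [Finite α] (f : α → α) :
    ∃ q, 1 ≤ q ∧ ∀ k, 1 ≤ k → ∀ x, f^[q] (f^[k * q] x) = f^[k * q] x := by
  obtain ⟨i, j, hij, h⟩ : ∃ i j, i < j ∧ f^[i] = f^[j] := by
    obtain ⟨i, j, hne, h⟩ := Finite.exists_ne_map_eq_of_infinite fun n : ℕ => f^[n]
    rcases lt_or_gt_of_ne hne with h' | h'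
    · exact ⟨i, j, h', h⟩
    · exact ⟨j, i, h', h.symm⟩
  obtain ⟨p, hp, rfl⟩ : ∃ p, 1 ≤ p ∧ j = i + p := ⟨j - i, by omega, by omega⟩
  have h1 : ∀ n, f^[n + i + p] = f^[n + i] := by
    intro n
    rw [add_assoc, Function.iterate_add, ← h, ← Function.iterate_add]
  have h2 : ∀ m n, f^[n + i + p * m] = f^[n + i] := by
    intro m n
    induction m with
    | zero => rfl
    | succ m ih =>
      have h3 := h1 (n + p * m)
      rw [show n + p * m + i + p = n + i + p * (m + 1) by ring,
        show n + p * m + i = n + i + p * m by ring, ih] at h3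
      exact h3
  -- A multiple of the period `p` that is also at least the preperiod `i`.
  refine ⟨p * (i + 1), Nat.mul_pos hp (by omega), fun k hk x => ?_⟩
  obtain ⟨n, hn⟩ : ∃ n, k * (p * (i + 1)) = n + i :=
    Nat.exists_eq_add_of_le'
      ((Nat.le_succ i).trans ((Nat.le_mul_of_pos_left _ hp).trans (Nat.le_mul_of_pos_left _ hk)))
  rw [← Function.iterate_add_apply, hn, add_comm, h2]

namespace Substitution

variable {A : Type*}

/-- The target of the edge of the graph `G` that starts at `D`. -/
def next (σ : Substitution A) (D : Set A) : Set A := ⋃ a ∈ D, σ.growingAlphabet (σ.toFun a)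

theorem mem_next {σ : Substitution A} {D : Set A} {c : A} :
    c ∈ σ.next D ↔ c ∈ σ.growing ∧ ∃ d ∈ D, c ∈ σ.toFun d := by
  simp only [next, Set.mem_iUnion, growingAlphabet, Set.mem_ofPred_eq, exists_prop]
  exact ⟨fun ⟨a, h1, h2, h3⟩ => ⟨h2, a, h1, h3⟩, fun ⟨h2, a, h1, h3⟩ => ⟨a, h1, h2, h3⟩⟩

theorem next_mono (σ : Substitution A) : Monotone σ.next :=
  fun _ _ h => Set.biUnion_subset_biUnion_left h

theorem IsVertex.next [Finite A] {σ : Substitution A} {D : Set A} (hD : σ.IsVertex D) :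
    σ.IsVertex (σ.next D) := by
  refine ⟨?_, fun c hc => (mem_next.1 hc).1⟩
  obtain ⟨d, hd⟩ := hD.1
  obtain ⟨p, c, s, h, -, hc⟩ := exists_first_growing (hD.2 hd)
  exact ⟨c, mem_next.2 ⟨hc, d, hd, by simp [h]⟩⟩

theorem IsVertex.next_iterate [Finite A] {σ : Substitution A} {D : Set A} (hD : σ.IsVertex D)
    (n : ℕ) : σ.IsVertex (σ.next^[n] D) := by
  induction n with
  | zero => exact hD
  | succ n ih =>
    rw [Function.iterate_succ_apply']
    exact ih.next

theorem mem_next_iterate {σ : Substitution A} {D : Set A} (hD : D ⊆ σ.growing) {n : ℕ} {c : A} :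
    c ∈ σ.next^[n] D ↔ c ∈ σ.growing ∧ ∃ d ∈ D, c ∈ σ.onWord^[n] [d] := by
  induction n generalizing c with
  | zero =>
    simp only [Function.iterate_zero, id_eq, List.mem_singleton, exists_eq_right']
    exact ⟨fun h => ⟨hD h, h⟩, fun h => h.2⟩
  | succ n ih =>
    rw [Function.iterate_succ_apply', mem_next]
    simp only [Function.iterate_succ_apply']
    constructor
    · rintro ⟨hc, a, ha, hca⟩
      obtain ⟨-, d, hd, had⟩ := ih.1 ha
      exact ⟨hc, d, hd, List.mem_flatMap.2 ⟨a, had, hca⟩⟩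
    · rintro ⟨hc, d, hd, hcd⟩
      obtain ⟨a, had, hca⟩ := List.mem_flatMap.1 hcd
      exact ⟨hc, a, ih.2 ⟨fun h => hc (σ.bounded_of_mem h hca), d, hd, had⟩, hca⟩

theorem arrow_iff [Finite A] {σ : Substitution A} {D E : Set A} :
    σ.Arrow D E ↔ σ.IsVertex D ∧ E = σ.next D :=
  ⟨fun h => ⟨h.1, h.2.2⟩, fun h => ⟨h.1, h.2 ▸ h.1.next, h.2⟩⟩

theorem arrowIter_iff [Finite A] {σ : Substitution A} {D E : Set A} (hD : σ.IsVertex D) {n : ℕ} :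
    σ.ArrowIter n D E ↔ σ.next^[n] D = E := by
  induction n generalizing D with
  | zero => rfl
  | succ n ih =>
    rw [Function.iterate_succ_apply, ← ih hD.next]
    constructor
    · rintro ⟨F, hF, h⟩
      rwa [(arrow_iff.1 hF).2] at h
    · exact fun h => ⟨_, arrow_iff.2 ⟨hD, rfl⟩, h⟩

theorem isPeriodicAlphabet_iff [Finite A] {σ : Substitution A} {D : Set A} {k : ℕ} :
    σ.IsPeriodicAlphabet k D ↔
      σ.IsVertex D ∧ IsLeast {j : ℕ | 1 ≤ j ∧ σ.next^[j] D = D} k := by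
  refine and_congr_right fun hD => ?_
  simp only [arrowIter_iff hD]

theorem exists_isPeriodicAlphabet [Finite A] {σ : Substitution A} {D : Set A} {j : ℕ}
    (hD : σ.IsVertex D) (hj : 1 ≤ j) (h : σ.next^[j] D = D) : ∃ k, σ.IsPeriodicAlphabet k D :=
  ⟨_, isPeriodicAlphabet_iff.2 ⟨hD, Nat.sInf_mem ⟨j, hj, h⟩, fun _ h => Nat.sInf_le h⟩⟩

theorem IsPeriodicAlphabet.one_le {σ : Substitution A} {D : Set A} {k : ℕ}
    (h : σ.IsPeriodicAlphabet k D) : 1 ≤ k := h.2.1.1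

theorem IsPeriodicAlphabet.next_iterate_eq [Finite A] {σ : Substitution A} {D : Set A} {k : ℕ}
    (h : σ.IsPeriodicAlphabet k D) : σ.next^[k] D = D := (isPeriodicAlphabet_iff.1 h).2.1.2

theorem IsPeriodicAlphabet.next_iterate_mul_eq [Finite A] {σ : Substitution A} {D : Set A} {k : ℕ}
    (h : σ.IsPeriodicAlphabet k D) (n : ℕ) : σ.next^[k * n] D = D := by
  rw [Function.iterate_mul]
  exact Function.iterate_fixed h.next_iterate_eq n

theorem IsPeriodicAlphabet.next [Finite A] {σ : Substitution A} {D : Set A} {k : ℕ}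
    (h : σ.IsPeriodicAlphabet k D) : σ.IsPeriodicAlphabet k (σ.next D) := by
  have hk := h.one_le
  have hD := h.next_iterate_eq
  rw [isPeriodicAlphabet_iff] at h ⊢
  refine ⟨h.1.next, ?_⟩
  convert h.2 using 1
  ext j
  simp only [Set.mem_ofPred_eq, ← Function.iterate_succ_apply]
  refine and_congr_right fun _ => ⟨fun hj => ?_, fun hj => ?_⟩
  · have := congrArg σ.next^[k - 1] hj
    rw [← Function.iterate_succ_apply, ← Function.iterate_add_apply,
      show k - 1 + (j + 1) = j + k by omega, Function.iterate_add_apply, hD,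
      Nat.succ_eq_add_one, Nat.sub_add_cancel hk, hD] at this
    exact this
  · rw [Function.iterate_succ_apply', hj]

/-- A periodic `E ⊆ σ.next D` is carried by `k - 1` further steps into `D`, hence onto `D` by
minimality. So `k` steps carry `E` onto `σ.next D`, as do `k l` steps, and these fix `E` when `l` is
its period. -/
theorem IsMinimalAlphabet.next [Finite A] {σ : Substitution A} {D : Set A} {k : ℕ}
    (h : σ.IsMinimalAlphabet k D) : σ.IsMinimalAlphabet k (σ.next D) := by
  refine ⟨h.1.next, fun E l hE hED => ?_⟩
  have hk := h.1.one_le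
  have hkD := h.1.next_iterate_eq
  have hper : ∀ n, σ.IsPeriodicAlphabet l (σ.next^[n] E) := by
    intro n
    induction n with
    | zero => exact hE
    | succ n ih =>
      rw [Function.iterate_succ_apply']
      exact ih.next
  have h1 : σ.next^[k - 1] E = D := by
    refine h.2 _ l (hper _) ?_
    have := σ.next_mono.iterate (k - 1) hED
    rwa [← Function.iterate_succ_apply, Nat.succ_eq_add_one, Nat.sub_add_cancel hk, hkD] at this
  have h2 : σ.next^[k] E = σ.next D := by
    rw [← h1, ← Function.iterate_succ_apply' σ.next, Nat.succ_eq_add_one, Nat.sub_add_cancel hk]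
  have h3 : σ.next^[k] (σ.next D) = σ.next D := h.1.next.next_iterate_eq
  have h4 : ∀ n, σ.next^[k * (n + 1)] E = σ.next D := by
    intro n
    induction n with
    | zero => simpa using h2
    | succ n ih => rw [mul_add, mul_one, add_comm, Function.iterate_add_apply, ih, h3]
  have hl := hE.one_le
  have h5 := h4 (l - 1)
  rw [Nat.sub_add_cancel hl, mul_comm, hE.next_iterate_mul_eq] at h5
  exact h5

/-- Both alphabets are fixed by `k * l` steps, so `k * l - 1` further steps undo `σ.next`. -/
theorem IsPeriodicAlphabet.next_injective [Finite A] {σ : Substitution A} {D E : Set A} {k l : ℕ}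
    (hD : σ.IsPeriodicAlphabet k D) (hE : σ.IsPeriodicAlphabet l E) (h : σ.next D = σ.next E) :
    D = E := by
  have hpos := Nat.mul_pos hD.one_le hE.one_le
  have := congrArg σ.next^[k * l - 1] h
  rwa [← Function.iterate_succ_apply, ← Function.iterate_succ_apply, Nat.succ_eq_add_one,
    Nat.sub_add_cancel hpos, hD.next_iterate_mul_eq, mul_comm, hE.next_iterate_mul_eq] at this

theorem IsPeriodicAlphabet.period_unique {σ : Substitution A} {D : Set A} {k l : ℕ}
    (hk : σ.IsPeriodicAlphabet k D) (hl : σ.IsPeriodicAlphabet l D) : k = l :=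
  hk.2.unique hl.2

theorem exists_isMinimalAlphabet_subset [Finite A] {σ : Substitution A} {E : Set A} {l : ℕ}
    (hE : σ.IsPeriodicAlphabet l E) : ∃ D ⊆ E, ∃ k, σ.IsMinimalAlphabet k D := by
  obtain ⟨D, hDE, ⟨k, hk⟩, hmin⟩ := exists_minimal_le_of_wellFoundedLT
    (fun D => ∃ k, σ.IsPeriodicAlphabet k D) E ⟨l, hE⟩
  exact ⟨D, hDE, k, hk, fun D' k' h1 h2 => h2.antisymm (hmin ⟨k', h1⟩ h2)⟩

/-- The periodic part of the graph `G` generates minimal alphabets. -/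
theorem IsMinimalAlphabet.exists_next_iterate_eq [Finite A] {σ : Substitution A} {D : Set A}
    {k : ℕ} (h : σ.IsMinimalAlphabet k D) :
    ∃ N, ∀ n ≥ N, ∀ d ∈ D, σ.next^[k * n] {d} = D := by
  obtain ⟨q, hq, hidem⟩ := Function.exists_iterate_idempotent σ.next
  refine ⟨q, fun n hn d hd => ?_⟩
  have hsub : {d} ⊆ D := Set.singleton_subset_iff.2 hd
  have hdv : σ.IsVertex {d} := ⟨⟨d, rfl⟩, hsub.trans h.1.1.2⟩
  have h1 : σ.next^[k * q] {d} = D := by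
    -- After `k * q` steps the orbit of `{d}` has become periodic and lies in `D`, so minimality
    -- applies.
    have hfix := hidem k h.1.one_le {d}
    obtain ⟨l, hl⟩ := exists_isPeriodicAlphabet (hdv.next_iterate (k * q)) hq hfix
    refine h.2 _ l hl ?_
    have := σ.next_mono.iterate (k * q) hsub
    rwa [h.1.next_iterate_mul_eq] at this
  obtain ⟨m, rfl⟩ := Nat.exists_eq_add_of_le' hn
  rw [mul_add, Function.iterate_add_apply, h1, h.1.next_iterate_mul_eq]

/-! ### Powers, primitivity and uniform recurrence -/

theorem pow_onWord (σ : Substitution A) (k : ℕ) : (σ.pow k).onWord = σ.onWord^[k] := by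
  ext1 w
  rw [iterate_eq_flatMap]
  rfl

theorem pow_iterate (σ : Substitution A) (k n : ℕ) :
    (σ.pow k).onWord^[n] = σ.onWord^[k * n] := by
  rw [pow_onWord, Function.iterate_mul]

theorem pow_bounded (σ : Substitution A) {k : ℕ} (hk : 1 ≤ k) :
    (σ.pow k).bounded = σ.bounded := by
  ext a
  constructor
  · rintro ⟨M, hM⟩
    refine ⟨M, fun n => le_trans ?_ (hM n)⟩
    rw [pow_iterate, ← Nat.sub_add_cancel (Nat.le_mul_of_pos_left n hk),
      Function.iterate_add_apply]
    exact σ.length_le_iterate _ _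
  · rintro ⟨M, hM⟩
    exact ⟨M, fun n => by rw [pow_iterate]; exact hM _⟩

theorem pow_growing (σ : Substitution A) {k : ℕ} (hk : 1 ≤ k) :
    (σ.pow k).growing = σ.growing := by
  rw [growing, pow_bounded σ hk, growing]

theorem nonIsolated_subset_pow (σ : Substitution A) {k : ℕ} (hk : 1 ≤ k) :
    σ.nonIsolated ⊆ (σ.pow k).nonIsolated := by
  rintro c ⟨h1, h2, h3⟩
  refine ⟨by rwa [pow_growing σ hk], ?_, ?_⟩
  · rintro ⟨-, n, hn, u, v, hu, huB, h⟩
    rw [pow_bounded σ hk] at huB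
    rw [pow_iterate] at h
    exact h2 ⟨h1, k * n, Nat.mul_pos hk hn, u, v, hu, huB, h⟩
  · rintro ⟨-, n, hn, u, v, hu, huB, h⟩
    rw [pow_bounded σ hk] at huB
    rw [pow_iterate] at h
    exact h3 ⟨h1, k * n, Nat.mul_pos hk hn, u, v, hu, huB, h⟩

/-- A closed alphabet on which the substitution is primitive. -/
structure IsPrimitiveAlphabet (σ : Substitution A) (D : Set A) : Prop
    extends σ.IsClosedAlphabet D where
  nonempty : D.Nonempty
  primitive : ∃ N, ∀ n ≥ N, ∀ d ∈ D, ∀ e ∈ D, e ∈ σ.onWord^[n] [d]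

theorem IsMinimalAlphabet.isPrimitiveAlphabet [Finite A] {σ : Substitution A} {D : Set A} {k : ℕ}
    (h : σ.IsMinimalAlphabet k D) : (σ.pow k).IsPrimitiveAlphabet D where
  growing := by
    rw [pow_growing σ h.1.one_le]
    exact h.1.1.2
  closed d hd c hc hcg := by
    rw [pow_growing σ h.1.one_le] at hcg
    rw [← h.1.next_iterate_eq, mem_next_iterate h.1.1.2]
    exact ⟨hcg, d, hd, hc⟩
  nonempty := h.1.1.1
  primitive := by
    obtain ⟨N, hN⟩ := h.exists_next_iterate_eq
    refine ⟨N, fun n hn d hd e he => ?_⟩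
    rw [← hN n hn d hd, mem_next_iterate (Set.singleton_subset_iff.2 (h.1.1.2 hd))] at he
    obtain ⟨-, d', rfl, h⟩ := he
    rwa [pow_iterate]

/-- The factors of the words generated by the letters of `D`. -/
def languageOn (σ : Substitution A) (D : Set A) : Set (List A) :=
  {u | ∃ d ∈ D, ∃ n, u <:+: σ.onWord^[n] [d]}

theorem languageOn_of_infix {σ : Substitution A} {D : Set A} {u w : List A}
    (hw : w ∈ σ.languageOn D) (h : u <:+: w) : u ∈ σ.languageOn D :=
  let ⟨d, hd, n, hn⟩ := hw
  ⟨d, hd, n, h.trans hn⟩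

theorem exists_length_iterate_le [Finite A] (σ : Substitution A) (N : ℕ) :
    ∃ l, ∀ n ≤ N, ∀ a, (σ.onWord^[n] [a]).length ≤ l := by
  obtain ⟨l, hl⟩ := (Set.finite_range fun a => (σ.onWord^[N] [a]).length).bddAbove
  refine ⟨l, fun n hn a => le_trans ?_ (hl ⟨a, rfl⟩)⟩
  show _ ≤ (σ.onWord^[N] [a]).length
  rw [← Nat.sub_add_cancel hn, Function.iterate_add_apply]
  exact σ.length_le_iterate _ _

/-- Long factors of `σ^m(a)` contain `σ^N` of long words. -/
theorem exists_iterate_infix [Finite A] (σ : Substitution A) (N K : ℕ) :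
    ∃ R, ∀ a m w, w <:+: σ.onWord^[m] [a] → R ≤ w.length → N ≤ m ∧
      ∃ v, v <:+: σ.onWord^[m - N] [a] ∧ K < v.length ∧ σ.onWord^[N] v <:+: w := by
  obtain ⟨l, hl⟩ := σ.exists_length_iterate_le N
  refine ⟨l * (K + 2) + 1, fun a m w hw hlen => ?_⟩
  have hNm : N ≤ m := by
    by_contra! h
    have h1 := hw.length_le.trans (hl m h.le a)
    nlinarith
  refine ⟨hNm, ?_⟩
  nth_rw 1 [← Nat.add_sub_cancel' hNm] at hw
  rw [Function.iterate_add_apply, iterate_eq_flatMap] at hw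
  obtain ⟨v, h1, h2, h3⟩ := List.exists_infix_flatMap _ (hl N le_rfl) _ hw
  refine ⟨v, h1, ?_, by rwa [iterate_eq_flatMap]⟩
  by_contra! h
  have := Nat.mul_le_mul_left l (show v.length + 2 ≤ K + 2 by omega)
  omega

/-- A long `w` contains `σ^(n+N)(v)` with `v` too long to be bounded, so `v` has a letter `c ∈ D`.
By primitivity `σ^N(c)` contains `d₀`, and `σ^n(d₀)` contains `u`. -/
theorem IsPrimitiveAlphabet.isUniformlyRecurrent [Finite A] {σ : Substitution A} {D : Set A}
    (hD : σ.IsPrimitiveAlphabet D) (hiso : D ⊆ σ.nonIsolated) :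
    IsUniformlyRecurrent (σ.languageOn D) := by
  obtain ⟨N, hN⟩ := hD.primitive
  obtain ⟨K, hK⟩ := hD.exists_infix_bound hiso
  rintro u ⟨d₀, hd₀, n, hu⟩
  obtain ⟨R, hR⟩ := σ.exists_iterate_infix (n + N) K
  refine ⟨R, ?_⟩
  rintro w ⟨d, hd, m, hw⟩ hlen
  obtain ⟨-, v, h1, h2, h3⟩ := hR d m w hw hlen
  obtain ⟨c, hcv, hc⟩ : ∃ c ∈ v, c ∉ σ.bounded := by
    by_contra! h
    have := hK d hd _ v h h1
    omega
  have hcD : c ∈ D := by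
    rcases hD.mem_iterate _ (w := [d]) (by simpa using Or.inl hd) c (h1.subset hcv) with h | h
    · exact h
    · exact absurd h hc
  refine hu.trans (List.IsInfix.trans ?_ ((σ.iterate_infix_of_mem (n + N) hcv).trans h3))
  rw [Function.iterate_add_apply]
  exact σ.iterate_infix_of_mem n (hN N le_rfl c hcD d₀ hd₀)

theorem IsPrimitiveAlphabet.subshiftOf_nonempty [Finite A] {σ : Substitution A} {D : Set A}
    (hD : σ.IsPrimitiveAlphabet D) : (subshiftOf (σ.languageOn D)).Nonempty := by
  refine _root_.subshiftOf_nonempty (fun w hw u hu => languageOn_of_infix hw hu) fun N => ?_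
  obtain ⟨d, hd⟩ := hD.nonempty
  by_contra! h
  exact hD.growing hd ⟨N, fun n => (h _ ⟨d, hd, n, List.infix_rfl⟩).le⟩

theorem IsPrimitiveAlphabet.mem_languageOn [Finite A] {σ : Substitution A} {D : Set A}
    (hD : σ.IsPrimitiveAlphabet D) {w : List A} (hw : w ∈ σ.languageOn D) :
    ∀ c ∈ w, c ∈ D ∪ σ.bounded := by
  obtain ⟨d, hd, n, h⟩ := hw
  exact fun c hc => hD.mem_iterate n (w := [d]) (by simpa using Or.inl hd) c (h.subset hc)

theorem restrict_iterate (σ : Substitution A) (D : Set A)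
    (h : ∀ a ∈ D, ∀ b ∈ σ.toFun a, b ∈ D) (n : ℕ) (w : List D) :
    ((σ.restrict D h).onWord^[n] w).map Subtype.val = σ.onWord^[n] (w.map Subtype.val) := by
  induction n generalizing w with
  | zero => rfl
  | succ n ih =>
    rw [Function.iterate_succ_apply, Function.iterate_succ_apply, ih]
    congr 1
    simp [onWord, restrict, List.map_flatMap]

theorem alphabetSubshift_eq [Finite A] {σ : Substitution A} {k : ℕ} {D : Set A}
    (hD : σ.IsMinimalAlphabet k D) :
    σ.alphabetSubshift hD.1 = subshiftOf ((σ.pow k).languageOn D) := by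
  have hk := hD.1.one_le
  apply Set.Subset.antisymm
  · rintro _ ⟨y, hy, rfl⟩
    obtain ⟨K, hK⟩ := (σ.pow k).exists_forall_length_le
    intro i n
    -- A factor longer than `K` cannot be generated by a bounded letter, so `a` is in `D`.
    obtain ⟨a, m, h⟩ := hy i (n + K + 1)
    have h1 := h.map Subtype.val
    rw [← factorAt_map, restrict_iterate] at h1
    refine languageOn_of_infix ⟨a, ?_, m, h1⟩ (factorAt_infix _ le_rfl (by omega))
    rcases a.2 with ha | ha
    · exact ha
    · have := h1.length_le.trans (hK a ((pow_bounded σ hk).symm ▸ ha) m)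
      rw [factorAt_length] at this
      omega
  · intro x hx
    have hmem : ∀ i, x i ∈ D ∪ σ.bounded := by
      intro i
      have := hD.isPrimitiveAlphabet.mem_languageOn (hx i 1) (x i) (by simp [factorAt])
      rwa [pow_bounded σ hk] at this
    refine ⟨fun i => ⟨x i, hmem i⟩, fun i n => ?_, rfl⟩
    obtain ⟨d, hd, m, s, t, h⟩ := hx i n
    refine ⟨⟨d, Or.inl hd⟩, m, ?_⟩
    have h1 := (σ.pow k).restrict_iterate _ hD.1.stable m [⟨d, Or.inl hd⟩]
    rw [List.map_singleton, ← h, List.map_eq_append_iff] at h1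
    obtain ⟨w, t', h2, h3, h4⟩ := h1
    obtain ⟨s', u', rfl, h5, h6⟩ := List.map_eq_append_iff.1 h3
    refine ⟨s', t', ?_⟩
    rw [h2]
    congr 2
    refine List.map_injective_iff.2 Subtype.val_injective ?_
    rw [h6, ← factorAt_map]

end Substitution

/-! ### Minimal alphabets and tame minimal components -/

namespace Substitution

variable {A : Type*}

/-- If `e`, a letter of `σ(d)`, were isolated, `σ^(k-1)` would carry its long bounded factors to
bounded factors, no shorter, of the words `σ^(k(m+1))(d)`, against the bound for `D`. -/
theorem nonIsolated_next [Finite A] {σ : Substitution A} {k : ℕ} {D : Set A}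
    (hD : σ.IsMinimalAlphabet k D) (hiso : D ⊆ σ.nonIsolated) : σ.next D ⊆ σ.nonIsolated := by
  intro e he
  have hk := hD.1.one_le
  obtain ⟨hcg, d, hd, hed⟩ := mem_next.1 he
  obtain ⟨K, hK⟩ := hD.isPrimitiveAlphabet.exists_infix_bound
    (hiso.trans (σ.nonIsolated_subset_pow hk))
  by_contra hne
  obtain ⟨m, u, huB, hlen, hu⟩ := exists_long_of_not_nonIsolated hcg hne hk K
  rw [← onWord_singleton] at hed
  have h1 := σ.iterate_infix (k - 1) (hu.trans (σ.iterate_infix_of_mem (k * m) hed))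
  rw [← Function.iterate_succ_apply, ← Function.iterate_add_apply,
    show k - 1 + (k * m).succ = k * (m + 1) by rw [mul_add]; omega, ← pow_iterate] at h1
  have h2 := hK d hd (m + 1) _ (by
    have := huB.iterate (k - 1)
    rwa [IsBoundedWord, ← pow_bounded σ hk] at this) h1
  have h3 := σ.length_le_iterate (k - 1) u
  omega

theorem isUniformlyRecurrent_languageOn_pow [Finite A] {σ : Substitution A} {k : ℕ} {D : Set A}
    (hD : σ.IsMinimalAlphabet k D) (hiso : D ⊆ σ.nonIsolated) :
    IsUniformlyRecurrent ((σ.pow k).languageOn D) :=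
  hD.isPrimitiveAlphabet.isUniformlyRecurrent (hiso.trans (σ.nonIsolated_subset_pow hD.1.one_le))

theorem isMinimalSubshift_alphabetSubshift [Finite A] {σ : Substitution A} {k : ℕ} {D : Set A}
    (hD : σ.IsMinimalAlphabet k D) (hiso : D ⊆ σ.nonIsolated) :
    IsMinimalSubshift (σ.alphabetSubshift hD.1) := by
  rw [alphabetSubshift_eq hD]
  exact (isUniformlyRecurrent_languageOn_pow hD hiso).isMinimalSubshift
    hD.isPrimitiveAlphabet.subshiftOf_nonempty

/-- The alphabet is recovered from the subshift as the set of its growing letters. -/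
theorem mem_alphabet_iff [Finite A] {σ : Substitution A} {k : ℕ} {D : Set A}
    (hD : σ.IsMinimalAlphabet k D) (hiso : D ⊆ σ.nonIsolated) {c : A} :
    c ∈ D ↔ c ∈ σ.growing ∧ ∃ x ∈ σ.alphabetSubshift hD.1, ∃ i, x i = c := by
  rw [alphabetSubshift_eq hD]
  constructor
  · intro hc
    obtain ⟨x, hx, i, hi⟩ := (isUniformlyRecurrent_languageOn_pow hD hiso).mem_languageOf
      hD.isPrimitiveAlphabet.subshiftOf_nonempty subset_rfl (u := [c])
      ⟨c, hc, 0, List.infix_rfl⟩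
    refine ⟨hD.1.1.2 hc, x, hx, i, ?_⟩
    simp [factorAt] at hi
    exact hi.symm
  · rintro ⟨hc, x, hx, i, rfl⟩
    have := hD.isPrimitiveAlphabet.mem_languageOn (hx i 1) (x i) (by simp [factorAt])
    rw [pow_bounded σ hD.1.one_le] at this
    exact this.resolve_right hc

theorem alphabetSubshift_injective [Finite A] {σ : Substitution A} {k l : ℕ} {D E : Set A}
    (hD : σ.IsMinimalAlphabet k D) (hDiso : D ⊆ σ.nonIsolated)
    (hE : σ.IsMinimalAlphabet l E) (hEiso : E ⊆ σ.nonIsolated)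
    (h : σ.alphabetSubshift hD.1 = σ.alphabetSubshift hE.1) : D = E := by
  ext c
  rw [mem_alphabet_iff hD hDiso, mem_alphabet_iff hE hEiso, h]

theorem isTameMinimalComponent_alphabetSubshift [Finite A] {σ : Substitution A} {k : ℕ}
    {D : Set A} (hD : σ.IsMinimalAlphabet k D) (hiso : D ⊆ σ.nonIsolated) :
    σ.IsTameMinimalComponent (σ.alphabetSubshift hD.1) := by
  refine ⟨isMinimalSubshift_alphabetSubshift hD hiso, ?_, fun h => ?_⟩
  · rw [alphabetSubshift_eq hD]
    intro x hx i n
    obtain ⟨d, -, m, h⟩ := hx i n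
    rw [pow_iterate] at h
    exact ⟨d, k * m, h⟩
  · obtain ⟨d, hd⟩ := hD.1.1.1
    obtain ⟨hdg, x, hx, i, rfl⟩ := (mem_alphabet_iff hD hiso).1 hd
    exact hdg (h hx i)

/-- By minimality of the target, inclusion suffices. A letter `d ∈ D` occurs in `σ^(k-1)(e)` for
some `e` in the next alphabet, so `σ(σ^(kN)(d))` is a factor of `σ^(k(N+1))(e)`. -/
theorem induced_alphabetSubshift [Finite A] {σ : Substitution A} {k : ℕ} {D : Set A}
    (hD : σ.IsMinimalAlphabet k D) (hiso : D ⊆ σ.nonIsolated) :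
    σ.induced (σ.alphabetSubshift hD.1) = σ.alphabetSubshift hD.next.1 := by
  refine (isMinimalSubshift_alphabetSubshift hD.next (nonIsolated_next hD hiso)).2 _
    (σ.isSubshift_induced (isMinimalSubshift_alphabetSubshift hD hiso).1) ?_
  have hk := hD.1.one_le
  rw [alphabetSubshift_eq hD, alphabetSubshift_eq hD.next]
  rintro _ ⟨x, hx, t, rfl⟩ i n
  rw [factorAt_shiftBy]
  obtain ⟨j, m, h1⟩ := σ.factorAt_onSeq_infix x (i + t) n
  obtain ⟨d, hd, N, h2⟩ := hx j m
  rw [← hD.1.next_iterate_eq, ← Nat.sub_add_cancel hk, Function.iterate_succ_apply,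
    mem_next_iterate hD.1.next.1.2] at hd
  obtain ⟨-, e, he, hde⟩ := hd
  refine ⟨e, he, N + 1, h1.trans ?_⟩
  rw [pow_iterate] at h2
  have h3 := σ.iterate_infix 1 (h2.trans (σ.iterate_infix_of_mem (k * N) hde))
  rw [← Function.iterate_add_apply, ← Function.iterate_add_apply,
    show 1 + k * N + (k - 1) = k * (N + 1) by rw [mul_add]; omega, ← pow_iterate] at h3
  exact h3

/-- Otherwise the bounded words of the language define a subshift contained in both `X` and `B^ℤ`;
by minimality it is `X`, which is tame. -/
theorem IsTameMinimalComponent.exists_bound [Finite A] {σ : Substitution A} {X : Set (ℤ → A)}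
    (hX : σ.IsTameMinimalComponent X) :
    ∃ K, ∀ u ∈ languageOf X, σ.IsBoundedWord u → u.length ≤ K := by
  by_contra! h
  let L : Set (List A) := {u | u ∈ languageOf X ∧ σ.IsBoundedWord u}
  have hne : (subshiftOf L).Nonempty := subshiftOf_nonempty
    (fun w hw u hu => ⟨mem_languageOf_of_infix hw.1 hu, hw.2.mono hu⟩) fun N =>
      let ⟨u, h1, h2, h3⟩ := h N
      ⟨u, ⟨h1, h2⟩, h3.le⟩
  have hLX := hX.1.2 _ (isSubshift_subshiftOf hne) fun x hx =>
    hX.1.1.mem_of_factors fun N => (hx _ _).1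
  refine hX.2.2 fun x hx i => ?_
  rw [← hLX] at hx
  exact (hx i 1).2 (x i) (by simp [factorAt])

/-- A long factor contains `σ^m(v)` with `|v| > K`. If `v` were bounded, `σ^m(v)` would be a bounded
factor longer than `K`. -/
theorem IsTameMinimalComponent.exists_iterate_mem [Finite A] {σ : Substitution A}
    {X : Set (ℤ → A)} (hX : σ.IsTameMinimalComponent X) (m : ℕ) :
    ∃ c ∈ σ.growing, σ.onWord^[m] [c] ∈ languageOf X := by
  obtain ⟨K, hK⟩ := hX.exists_bound
  obtain ⟨R, hR⟩ := σ.exists_iterate_infix m K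
  obtain ⟨x, hx⟩ := hX.1.1.1
  obtain ⟨a, n, h⟩ := hX.2.1 hx 0 R
  obtain ⟨-, v, -, h1, h2⟩ := hR a n _ h (factorAt_length x 0 R).ge
  have h3 := mem_languageOf_of_infix (factorAt_mem_languageOf hx 0 R) h2
  by_contra! hno
  have hv : σ.IsBoundedWord v := by
    intro c hc
    by_contra hcg
    exact hno c hcg (mem_languageOf_of_infix h3 (σ.iterate_infix_of_mem m hc))
  have h4 := hK _ h3 (hv.iterate m)
  have h5 := σ.length_le_iterate m v
  omega

theorem IsTameMinimalComponent.exists_alphabet [Finite A] {σ : Substitution A}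
    {X : Set (ℤ → A)} (hX : σ.IsTameMinimalComponent X) :
    ∃ D ⊆ σ.nonIsolated, ∃ (k : ℕ) (hD : σ.IsMinimalAlphabet k D),
      X = σ.alphabetSubshift hD.1 := by
  obtain ⟨q, hq, hidem⟩ := Function.exists_iterate_idempotent σ.next
  choose f hfg hf using fun j => hX.exists_iterate_mem (q * j)
  -- One growing letter `c` has `σ^(qj)(c)` in the language for infinitely many `j`.
  obtain ⟨c, hc⟩ := Finite.exists_infinite_fiber f
  have hcinf := Set.infinite_coe_iff.1 hc
  have hcg : c ∈ σ.growing := by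
    obtain ⟨j, rfl⟩ := hcinf.nonempty
    exact hfg j
  have hcv : σ.IsVertex {c} := ⟨⟨c, rfl⟩, Set.singleton_subset_iff.2 hcg⟩
  have hqc := hidem 1 le_rfl {c}
  rw [one_mul] at hqc
  obtain ⟨l, hl⟩ := exists_isPeriodicAlphabet (hcv.next_iterate q) hq hqc
  obtain ⟨D, hDE, k, hD⟩ := exists_isMinimalAlphabet_subset hl
  have hk := hD.1.one_le
  have hqD : σ.next^[q] D = D := by
    have := hidem k hk D
    rwa [hD.1.next_iterate_mul_eq] at this
  -- With `j = i + 1` large, split `q j` as `k n + s + q`: `q` steps lead from `c` to some `d' ∈ D`,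
  -- then `s` steps lead from `d'` to `d`. The latter is possible because `D` is fixed by `q i` and
  -- by `k n` steps, hence by `s`.
  have hlang : ∀ d ∈ D, ∀ n, σ.onWord^[k * n] [d] ∈ languageOf X := by
    intro d hd n
    obtain ⟨j, hj, hjn⟩ := hcinf.exists_gt (k * n + 1)
    obtain ⟨i, rfl⟩ : ∃ i, j = i + 1 := ⟨j - 1, by omega⟩
    obtain ⟨s, hs⟩ : ∃ s, q * i = k * n + s := Nat.exists_eq_add_of_le (by nlinarith)
    have hsD : σ.next^[s] D = D := by
      rw [← hD.1.next_iterate_mul_eq n, ← Function.iterate_add_apply, add_comm, ← hs,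
        Function.iterate_mul, Function.iterate_fixed hqD, hD.1.next_iterate_mul_eq]
    rw [← hsD, mem_next_iterate hD.1.1.2] at hd
    obtain ⟨-, d', hd', hdd'⟩ := hd
    obtain ⟨-, c', rfl, hcd⟩ := (mem_next_iterate hcv.2).1 (hDE hd')
    have h1 := σ.iterate_infix_of_mem (k * n) hdd'
    rw [← Function.iterate_add_apply, ← hs] at h1
    have h2 := h1.trans (σ.iterate_infix_of_mem (q * i) hcd)
    rw [← Function.iterate_add_apply, ← mul_add_one] at h2
    have h3 := hf (i + 1)
    rw [show f (i + 1) = c' from hj] at h3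
    exact mem_languageOf_of_infix h3 h2
  have hiso : D ⊆ σ.nonIsolated := by
    intro d hd
    by_contra hne
    obtain ⟨K, hK⟩ := hX.exists_bound
    obtain ⟨m, u, huB, hlen, hu⟩ := exists_long_of_not_nonIsolated (hD.1.1.2 hd) hne hk K
    exact (hK u (mem_languageOf_of_infix (hlang d hd m) hu) huB).not_gt hlen
  refine ⟨D, hiso, k, hD, ?_⟩
  refine (hX.1.2 _ (isMinimalSubshift_alphabetSubshift hD hiso).1 ?_).symm
  rw [alphabetSubshift_eq hD]
  refine fun x hx => hX.1.1.mem_of_factors fun N => ?_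
  obtain ⟨d, hd, n, h⟩ := hx (-N) (2 * N + 1)
  rw [pow_iterate] at h
  exact mem_languageOf_of_infix (hlang d hd n) h

end Substitution

/-! ### The proposition -/

theorem mainTheorem7 {A : Type*} [Finite A] (σ : Substitution A) :
    (∀ (D E : Set A) (k : ℕ) (hD : σ.IsMinimalAlphabet k D),
      D ⊆ σ.nonIsolated → σ.Arrow D E →
        E ⊆ σ.nonIsolated ∧ ∃ hE : σ.IsMinimalAlphabet k E,
          σ.induced (σ.alphabetSubshift hD.1) = σ.alphabetSubshift hE.1) ∧
    (∀ (D : Set A) (k : ℕ) (hD : σ.IsMinimalAlphabet k D),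
      D ⊆ σ.nonIsolated → σ.IsTameMinimalComponent (σ.alphabetSubshift hD.1)) ∧
    (∀ X : Set (ℤ → A), σ.IsTameMinimalComponent X →
      ∃! D : Set A, D ⊆ σ.nonIsolated ∧
        ∃ (k : ℕ) (hD : σ.IsMinimalAlphabet k D), X = σ.alphabetSubshift hD.1) ∧
    (∀ (D E : Set A) (k l : ℕ) (hD : σ.IsMinimalAlphabet k D) (hE : σ.IsMinimalAlphabet l E),
      D ⊆ σ.nonIsolated → E ⊆ σ.nonIsolated →
        (σ.induced (σ.alphabetSubshift hD.1) = σ.alphabetSubshift hE.1 ↔ σ.Arrow D E)) ∧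
    Set.BijOn σ.induced {X | σ.IsTameMinimalComponent X} {X | σ.IsTameMinimalComponent X} := by
  have hA : ∀ {D E : Set A}, σ.Arrow D E → E = σ.next D := fun h => (Substitution.arrow_iff.1 h).2
  refine ⟨?_, fun D k hD hiso => Substitution.isTameMinimalComponent_alphabetSubshift hD hiso,
    ?_, ?_, ?_, ?_, ?_⟩
  · intro D E k hD hiso hDE
    obtain rfl := hA hDE
    exact ⟨Substitution.nonIsolated_next hD hiso, hD.next,
      Substitution.induced_alphabetSubshift hD hiso⟩
  · intro X hX
    obtain ⟨D, hiso, k, hD, rfl⟩ := hX.exists_alphabet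
    refine ⟨D, ⟨hiso, k, hD, rfl⟩, ?_⟩
    rintro E ⟨hEiso, l, hE, h⟩
    exact (Substitution.alphabetSubshift_injective hD hiso hE hEiso h).symm
  · intro D E k l hD hE hDiso hEiso
    rw [Substitution.induced_alphabetSubshift hD hDiso]
    constructor
    · intro h
      exact Substitution.arrow_iff.2 ⟨hD.1.1, (Substitution.alphabetSubshift_injective hD.next
        (Substitution.nonIsolated_next hD hDiso) hE hEiso h).symm⟩
    · intro h
      obtain rfl := hA h
      obtain rfl := hD.next.1.period_unique hE.1
      rfl
  · intro X hX
    obtain ⟨D, hiso, k, hD, rfl⟩ := Substitution.IsTameMinimalComponent.exists_alphabet hX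
    rw [Substitution.induced_alphabetSubshift hD hiso]
    exact Substitution.isTameMinimalComponent_alphabetSubshift hD.next
      (Substitution.nonIsolated_next hD hiso)
  · intro X hX Y hY h
    obtain ⟨D, hDiso, k, hD, rfl⟩ := Substitution.IsTameMinimalComponent.exists_alphabet hX
    obtain ⟨E, hEiso, l, hE, rfl⟩ := Substitution.IsTameMinimalComponent.exists_alphabet hY
    rw [Substitution.induced_alphabetSubshift hD hDiso,
      Substitution.induced_alphabetSubshift hE hEiso] at h
    obtain rfl := hD.1.next_injective hE.1 (Substitution.alphabetSubshift_injective hD.next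
      (Substitution.nonIsolated_next hD hDiso) hE.next (Substitution.nonIsolated_next hE hEiso) h)
    obtain rfl := hD.1.period_unique hE.1
    rfl
  · intro X hX
    obtain ⟨D, hiso, k, hD, rfl⟩ := Substitution.IsTameMinimalComponent.exists_alphabet hX
    have hiter : ∀ n, ∃ hDn : σ.IsMinimalAlphabet k (σ.next^[n] D),
        σ.next^[n] D ⊆ σ.nonIsolated := by
      intro n
      induction n with
      | zero => exact ⟨hD, hiso⟩
      | succ n ih =>
        obtain ⟨h1, h2⟩ := ih
        rw [Function.iterate_succ_apply']
        exact ⟨h1.next, Substitution.nonIsolated_next h1 h2⟩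
    -- The predecessor of `D` on its cycle in `G` is reached from `D` in `k - 1` steps.
    obtain ⟨h1, h2⟩ := hiter (k - 1)
    refine ⟨_, Substitution.isTameMinimalComponent_alphabetSubshift h1 h2, ?_⟩
    rw [Substitution.induced_alphabetSubshift h1 h2]
    congr 1
    rw [← Function.iterate_succ_apply' σ.next, Nat.succ_eq_add_one,
      Nat.sub_add_cancel hD.1.one_le, hD.1.next_iterate_eq]
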